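/- Let $1/10 < H < 1/2$ and let $B = \{B_t,\ t \ge 0\}$ be a fractional Brownian motion with Hurst parameter $H$ on a probability space $(\Omega,\mathcal F,\mathbb P)$, that is, a centered Gaussian process with $$\mathbb E[B_sB_t] = \tfrac12\left(s^{2H} + t^{2H} - |t-s|^{2H}\right), \qquad s,t \ge 0.$$ Let $g \in C^\infty(\mathbb R)$ be real-valued and such that $g$ and each of its derivatives have moderate growth, where a function $f:\mathbb R\to\mathbb R$ has moderate growth if there are constants $A$, $b$ and $\alpha<2$ (depending on $f$) such that $|f(x)| \le A e^{b|x|^\alpha}$ for all $x \in \mathbb R$. For $n \ge 1$ and $j \ge 0$ put $\Delta B_{j/n} = B_{(j+1)/n} - B_{j/n}$ and $\widetilde B_{j/n} = \frac12\left(B_{j/n} + B_{(j+1)/n}\right)$. Then for every $t \ge 0$ the Simpson's rule Riemann sums $$\sum_{j=0}^{\lfloor nt\rfloor - 1} \frac16\left(g'(B_{j/n}) + 4g'(\widetilde B_{j/n}) + g'(B_{(j+1)/n})\right)\Delta B_{j/n}$$ converge in probability, as $n\to\infty$, to $g(B_t) - g(0)$. -/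

import Mathlib

open MeasureTheory ProbabilityTheory Filter
open scoped NNReal

/-- `f` satisfies moderate growth conditions: there are constants `A`, `b` and `α < 2` with
`|f x| ≤ A * exp (b * |x| ^ α)` for every real `x`. -/
def ModerateGrowth (f : ℝ → ℝ) : Prop :=
  ∃ A b α : ℝ, α < 2 ∧ ∀ x : ℝ, |f x| ≤ A * Real.exp (b * |x| ^ α)

/-- `B`, indexed by times `t ≥ 0`, is a fractional Brownian motion with Hurst parameter `H`
under `P`: a centered Gaussian process with covariance
`E[B_s B_t] = (s ^ (2H) + t ^ (2H) - |t - s| ^ (2H)) / 2`.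
(`IsGaussianProcess` forces `P` to be a probability measure.) -/
structure IsFractionalBrownianMotion {Ω : Type*} [MeasurableSpace Ω] (H : ℝ)
    (B : ℝ≥0 → Ω → ℝ) (P : Measure Ω) : Prop where
  isGaussianProcess : IsGaussianProcess B P
  centered : ∀ t : ℝ≥0, ∫ ω, B t ω ∂P = 0
  covariance : ∀ s t : ℝ≥0, ∫ ω, B s ω * B t ω ∂P =
    (1 / 2) * ((s : ℝ) ^ (2 * H) + (t : ℝ) ^ (2 * H) - |(t : ℝ) - (s : ℝ)| ^ (2 * H))

/-- The Simpson's rule Riemann sum of `g'` along the path `b` on `[0, t]`, for the uniform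
partition of mesh `1 / n`. -/
noncomputable def simpsonSum (g : ℝ → ℝ) (b : ℝ≥0 → ℝ) (t : ℝ≥0) (n : ℕ) : ℝ :=
  ∑ j ∈ Finset.range ⌊(n : ℝ≥0) * t⌋₊,
    (1 / 6) *
      (deriv g (b ((j : ℝ≥0) / n)) +
        4 * deriv g ((1 / 2) * (b ((j : ℝ≥0) / n) + b (((j : ℝ≥0) + 1) / n))) +
        deriv g (b (((j : ℝ≥0) + 1) / n))) *
      (b (((j : ℝ≥0) + 1) / n) - b ((j : ℝ≥0) / n))

/-!
Simpson's rule is exact for polynomials of degree at most `3` and symmetric about the midpoint, so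
its error on a step is a combination of `g⁽ᵏ⁾(midpoint) * ΔBᵏ` with `k = 5, 7, 9`, up to a remainder
of order `|ΔB|¹⁰`; the remainders add up to `O(n ^ (1 - 10 H))`. Bounding the sums of odd order by
absolute values would need `5 H > 1`. For `2 H ≤ 1` their second moments are instead expanded by
Gaussian integration by parts: after normalizing the increments and because `k` is odd, every term
acquires either the covariance of two increments or a product of two covariances of an increment
with a midpoint. Since `t ^ (2 H)` is concave, these add up to `O(n)` over the `n²` pairs of steps,
and the second moment is `O(n ^ (1 - 2 H k))`.
-/
section GaussianReal

variable {m : ℝ} {v : ℝ≥0}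

theorem integrable_gaussianReal_iff (hv : v ≠ 0) {f : ℝ → ℝ} :
    Integrable f (gaussianReal m v) ↔ Integrable fun x => gaussianPDFReal m v x * f x := by
  rw [gaussianReal_of_var_ne_zero _ hv,
    integrable_withDensity_iff_integrable_smul' (measurable_gaussianPDF _ _)
      (ae_of_all _ fun _ => gaussianPDF_lt_top)]
  simp only [toReal_gaussianPDF, smul_eq_mul]

theorem hasDerivAt_gaussianPDFReal (x : ℝ) :
    HasDerivAt (gaussianPDFReal m v) (-((x - m) / v * gaussianPDFReal m v x)) x := by
  have h : HasDerivAt (fun y : ℝ => -(y - m) ^ 2 / (2 * v)) (-(2 * (x - m)) / (2 * v)) x := by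
    simpa using ((((hasDerivAt_id x).sub_const m).pow 2).neg).div_const (2 * (v : ℝ))
  convert! h.exp.const_mul (√(2 * Real.pi * v))⁻¹ using 1
  rw [gaussianPDFReal, ← mul_neg 2 (x - m), mul_div_mul_left _ _ two_ne_zero]
  ring

theorem integral_sub_mean_mul_gaussianReal {φ φ' : ℝ → ℝ} (hφ : ∀ x, HasDerivAt φ (φ' x) x)
    (h₁ : Integrable φ (gaussianReal m v))
    (h₂ : Integrable (fun x => (x - m) * φ x) (gaussianReal m v))
    (h₃ : Integrable φ' (gaussianReal m v)) :
    ∫ x, (x - m) * φ x ∂gaussianReal m v = v * ∫ x, φ' x ∂gaussianReal m v := by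
  rcases eq_or_ne v 0 with rfl | hv
  · simp [gaussianReal_zero_var]
  rw [integrable_gaussianReal_iff hv] at h₁ h₂ h₃
  have parts := integral_mul_deriv_eq_deriv_mul_of_integrable (fun x _ => hφ x)
    (fun x _ => hasDerivAt_gaussianPDFReal (m := m) (v := v) x)
    ((h₂.const_mul (-(v : ℝ)⁻¹)).congr (ae_of_all _ fun x => by simp only [Pi.mul_apply]; ring))
    (h₃.congr (ae_of_all _ fun x => mul_comm _ _)) (h₁.congr (ae_of_all _ fun x => mul_comm _ _))
  rw [integral_gaussianReal_eq_integral_smul hv, integral_gaussianReal_eq_integral_smul hv]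
  calc ∫ x, gaussianPDFReal m v x • ((x - m) * φ x)
      = ∫ x, -v * (φ x * -((x - m) / v * gaussianPDFReal m v x)) := by
        refine integral_congr_ae (ae_of_all _ fun x => ?_)
        have : (v : ℝ) ≠ 0 := mod_cast hv
        simp only [smul_eq_mul]
        field_simp
    _ = v * ∫ x, gaussianPDFReal m v x • φ' x := by
        rw [integral_const_mul, parts, neg_mul_neg]
        simp only [smul_eq_mul, mul_comm]

theorem gaussianPDFReal_zero_mul_exp_mul_sq (hv : v ≠ 0) (l x : ℝ) :
    gaussianPDFReal 0 v x * Real.exp (l * x ^ 2) =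
      (√(2 * Real.pi * v))⁻¹ * Real.exp (-((1 - 2 * l * v) / (2 * v)) * x ^ 2) := by
  have : (v : ℝ) ≠ 0 := mod_cast hv
  rw [gaussianPDFReal, mul_assoc, ← Real.exp_add]
  congr 2
  field_simp
  ring

theorem integrable_exp_mul_sq_gaussianReal {l : ℝ} (hl : 2 * l * v < 1) :
    Integrable (fun x => Real.exp (l * x ^ 2)) (gaussianReal 0 v) := by
  rcases eq_or_ne v 0 with rfl | hv
  · rw [gaussianReal_zero_var]
    exact integrable_dirac (by simp)
  simp only [integrable_gaussianReal_iff hv, gaussianPDFReal_zero_mul_exp_mul_sq hv]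
  have : 0 < v := pos_iff_ne_zero.2 hv
  exact (integrable_exp_neg_mul_sq (div_pos (by linarith) (by positivity))).const_mul _

theorem integral_exp_mul_sq_gaussianReal {l : ℝ} (hl : 2 * l * v < 1) :
    ∫ x, Real.exp (l * x ^ 2) ∂gaussianReal 0 v = (√(1 - 2 * l * v))⁻¹ := by
  rcases eq_or_ne v 0 with rfl | hv
  · simp [gaussianReal_zero_var]
  have : (0 : ℝ) < v := mod_cast pos_iff_ne_zero.2 hv
  have : 0 < 1 - 2 * l * v := by linarith
  simp only [integral_gaussianReal_eq_integral_smul hv, smul_eq_mul,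
    gaussianPDFReal_zero_mul_exp_mul_sq hv]
  rw [integral_const_mul, integral_gaussian, ← Real.sqrt_inv, ← Real.sqrt_inv,
    ← Real.sqrt_mul (by positivity)]
  congr 1
  field_simp

end GaussianReal

section HasGaussianLaw

variable {Ω : Type*} [MeasurableSpace Ω] {P : Measure Ω}

theorem map_eq_gaussianReal_of_integral_eq_zero {X : Ω → ℝ} (hX : HasGaussianLaw X P)
    (h0 : ∫ ω, X ω ∂P = 0) : P.map X = gaussianReal 0 Var[X; P].toNNReal := by
  rw [hX.map_eq_gaussianReal, h0]

theorem integrable_exp_mul_sq {X : Ω → ℝ} (hX : HasGaussianLaw X P) (h0 : ∫ ω, X ω ∂P = 0)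
    {l : ℝ} (hl : l * Var[X; P] ≤ 1 / 4) : Integrable (fun ω => Real.exp (l * X ω ^ 2)) P := by
  have h : Integrable (fun x => Real.exp (l * x ^ 2)) (P.map X) := by
    rw [map_eq_gaussianReal_of_integral_eq_zero hX h0]
    refine integrable_exp_mul_sq_gaussianReal ?_
    rw [Real.coe_toNNReal _ (variance_nonneg _ _)]
    linarith
  exact h.comp_aemeasurable hX.aemeasurable

theorem integral_exp_mul_sq_le {X : Ω → ℝ} (hX : HasGaussianLaw X P) (h0 : ∫ ω, X ω ∂P = 0)
    {l : ℝ} (hl : l * Var[X; P] ≤ 1 / 4) : ∫ ω, Real.exp (l * X ω ^ 2) ∂P ≤ √2 := by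
  have hv := Real.coe_toNNReal _ (variance_nonneg X P)
  rw [← integral_map (f := fun x => Real.exp (l * x ^ 2)) hX.aemeasurable
      (Measurable.aestronglyMeasurable (by fun_prop)),
    map_eq_gaussianReal_of_integral_eq_zero hX h0,
    integral_exp_mul_sq_gaussianReal (by rw [hv]; linarith), hv, ← Real.sqrt_inv]
  refine Real.sqrt_le_sqrt (inv_le_of_inv_le₀ two_pos ?_)
  linarith

end HasGaussianLaw

section Stein

variable {Ω : Type*} [MeasurableSpace Ω] {P : Measure Ω}

theorem variance_mul_inv_mul_covariance [IsFiniteMeasure P] {Y : Ω → ℝ} (hY : MemLp Y 2 P)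
    (Z : Ω → ℝ) : Var[Y; P] * (Var[Y; P]⁻¹ * cov[Y, Z; P]) = cov[Y, Z; P] := by
  rw [← mul_assoc]
  rcases eq_or_ne Var[Y; P] 0 with h | h
  · have hcov : cov[Y, Z; P] = 0 := by
      refine integral_eq_zero_of_ae ?_
      filter_upwards [ae_eq_integral_of_variance_eq_zero hY h] with ω hω
      simp [hω]
    rw [hcov, mul_zero]
  · rw [mul_inv_cancel₀ h, one_mul]

theorem integral_mul_of_indepFun {E : Type*} [MeasurableSpace E] {Z : Ω → ℝ} {W : Ω → E}
    (hZ : HasGaussianLaw Z P) (h0 : ∫ ω, Z ω ∂P = 0) (hW : AEMeasurable W P)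
    (hZW : IndepFun Z W P) {φ φ' : ℝ × E → ℝ} (hφ : Measurable φ) (hφ' : Measurable φ')
    (hd : ∀ z w, HasDerivAt (fun z => φ (z, w)) (φ' (z, w)) z)
    (h₁ : Integrable (fun ω => φ (Z ω, W ω)) P)
    (h₂ : Integrable (fun ω => Z ω * φ (Z ω, W ω)) P)
    (h₃ : Integrable (fun ω => φ' (Z ω, W ω)) P) :
    ∫ ω, Z ω * φ (Z ω, W ω) ∂P = Var[Z; P] * ∫ ω, φ' (Z ω, W ω) ∂P := by
  have := hZ.isProbabilityMeasure
  have := Measure.isProbabilityMeasure_map hW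
  have hpair : AEMeasurable (fun ω => (Z ω, W ω)) P := hZ.aemeasurable.prodMk hW
  have hlaw : P.map (fun ω => (Z ω, W ω)) = (gaussianReal 0 Var[Z; P].toNNReal).prod (P.map W) := by
    rw [(indepFun_iff_map_prod_eq_prod_map_map hZ.aemeasurable hW).1 hZW,
      map_eq_gaussianReal_of_integral_eq_zero hZ h0]
  have transfer {f : ℝ × E → ℝ} (hf : Measurable f) (hi : Integrable (fun ω => f (Z ω, W ω)) P) :
      Integrable f ((gaussianReal 0 Var[Z; P].toNNReal).prod (P.map W)) :=
    hlaw ▸ (integrable_map_measure hf.aestronglyMeasurable hpair).2 hi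
  have integral_eq {f : ℝ × E → ℝ} (hf : Measurable f)
      (hi : Integrable (fun ω => f (Z ω, W ω)) P) : ∫ ω, f (Z ω, W ω) ∂P =
        ∫ w, ∫ z, f (z, w) ∂gaussianReal 0 Var[Z; P].toNNReal ∂P.map W := by
    rw [← integral_prod_symm _ (transfer hf hi), ← hlaw,
      integral_map hpair hf.aestronglyMeasurable]
  have hmul : Measurable fun u : ℝ × E => u.1 * φ u := measurable_fst.mul hφ
  rw [integral_eq hmul h₂, integral_eq hφ' h₃, ← integral_const_mul]
  refine integral_congr_ae ?_
  filter_upwards [(transfer hφ h₁).prod_left_ae, (transfer hmul h₂).prod_left_ae,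
    (transfer hφ' h₃).prod_left_ae] with w i₁ i₂ i₃
  have parts := integral_sub_mean_mul_gaussianReal (hd · w) i₁
    (by simpa only [sub_zero] using i₂) i₃
  simpa only [sub_zero, Real.coe_toNNReal _ (variance_nonneg _ _)] using parts

variable {ι : Type*} [Finite ι] {X : ι → Ω → ℝ}

theorem indepFun_sub_smul_of_covariance (hX : HasGaussianLaw (fun ω i => X i ω) P) (i : ι)
    {a : ι → ℝ} (ha : ∀ j, Var[X i; P] * a j = cov[X i, X j; P]) :
    IndepFun (X i) (fun ω j => X j ω - a j * X i ω) P := by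
  have := Fintype.ofFinite ι
  have := hX.isProbabilityMeasure
  have hL2 j : MemLp (X j) 2 P := (hX.eval j).memLp_two
  let L : (ι → ℝ) →L[ℝ] (Unit → ℝ) × (ι → ℝ) :=
    (ContinuousLinearMap.pi fun _ => ContinuousLinearMap.proj i).prod
      (ContinuousLinearMap.pi fun j =>
        ContinuousLinearMap.proj j - a j • ContinuousLinearMap.proj i)
  have h := HasGaussianLaw.indepFun_of_covariance_eval (X := fun _ : Unit => X i)
    (Y := fun j ω => X j ω - a j * X i ω) (hX.map L) fun _ j => by
      rw [covariance_fun_sub_right (hL2 i) (hL2 j) ((hL2 i).const_mul _),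
        covariance_const_mul_right, covariance_self (hL2 i).aemeasurable, mul_comm, ha, sub_self]
  exact h.comp (φ := fun x : Unit → ℝ => x ()) (measurable_pi_apply _) measurable_id

/-- Stein's identity: integrate by parts in `z` after writing `X = W + z • a`, with `z = X i` and
`W` independent of `X i`. -/
theorem integral_mul_eq_integral_fderiv (hX : HasGaussianLaw (fun ω i => X i ω) P) {i : ι}
    (h0 : ∫ ω, X i ω ∂P = 0) {F : (ι → ℝ) → ℝ} (hF : Differentiable ℝ F)
    (h₁ : Integrable (fun ω => F (X · ω)) P)
    (h₂ : Integrable (fun ω => X i ω * F (X · ω)) P)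
    (h₃ : Integrable (fun ω => fderiv ℝ F (X · ω) fun j => cov[X i, X j; P]) P) :
    ∫ ω, X i ω * F (X · ω) ∂P = ∫ ω, fderiv ℝ F (X · ω) (fun j => cov[X i, X j; P]) ∂P := by
  have := Fintype.ofFinite ι
  have := hX.isProbabilityMeasure
  set a : ι → ℝ := fun j => Var[X i; P]⁻¹ * cov[X i, X j; P] with ha
  have hvar_mul j : Var[X i; P] * a j = cov[X i, X j; P] :=
    variance_mul_inv_mul_covariance (hX.eval i).memLp_two _
  have hXa ω : (fun j => X j ω - a j * X i ω) + X i ω • a = (X · ω) := by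
    ext j
    simp only [Pi.add_apply, Pi.smul_apply, smul_eq_mul]
    ring
  have hfderiv x : fderiv ℝ F x (fun j => cov[X i, X j; P]) = Var[X i; P] * fderiv ℝ F x a := by
    rw [← smul_eq_mul, ← map_smul]
    exact congrArg _ (funext fun j => (hvar_mul j).symm)
  have hder z w : HasDerivAt (fun z : ℝ => F (w + z • a)) (fderiv ℝ F (w + z • a) a) z := by
    have hline : HasDerivAt (fun z : ℝ => w + z • a) a z := by
      simpa using ((hasDerivAt_id z).smul_const a).const_add w
    exact (hF _).hasFDerivAt.comp_hasDerivAt z hline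
  have hshift : Measurable fun u : ℝ × (ι → ℝ) => u.2 + u.1 • a := by fun_prop
  have ha_int : Integrable (fun ω => fderiv ℝ F (X · ω) a) P := by
    simpa only [ha, ← smul_eq_mul, ← Pi.smul_def, map_smul] using h₃.const_mul Var[X i; P]⁻¹
  have parts := integral_mul_of_indepFun (hX.eval i) h0 (W := fun ω j => X j ω - a j * X i ω)
    (aemeasurable_pi_lambda _ fun j =>
      (hX.eval j).aemeasurable.sub ((hX.eval i).aemeasurable.const_mul _))
    (indepFun_sub_smul_of_covariance hX i hvar_mul)
    (φ := fun u => F (u.2 + u.1 • a)) (φ' := fun u => fderiv ℝ F (u.2 + u.1 • a) a)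
    (hF.continuous.measurable.comp hshift) ((measurable_fderiv_apply_const ℝ F a).comp hshift)
    hder (by simpa only [hXa] using h₁) (by simpa only [hXa] using h₂)
    (by simpa only [hXa] using ha_int)
  simpa only [hXa, hfderiv, integral_const_mul] using parts

end Stein
/-- Sub-Gaussian growth: `f` is measurable and `O(exp (ε x ^ 2))` for every `ε > 0`, so that it is
integrable against every Gaussian law. Unlike moderate growth, this is visibly stable under
products. -/
structure SubGaussianGrowth (f : ℝ → ℝ) : Prop where
  measurable : Measurable f
  exists_bound : ∀ ε > 0, ∃ C, ∀ x, |f x| ≤ C * Real.exp (ε * x ^ 2)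

namespace SubGaussianGrowth

variable {f g : ℝ → ℝ}

theorem exists_nonneg_bound (hf : SubGaussianGrowth f) {ε : ℝ} (hε : 0 < ε) :
    ∃ C, 0 ≤ C ∧ ∀ x, |f x| ≤ C * Real.exp (ε * x ^ 2) := by
  obtain ⟨C, hC⟩ := hf.exists_bound ε hε
  exact ⟨C, by simpa using (abs_nonneg _).trans (hC 0), hC⟩

theorem mul (hf : SubGaussianGrowth f) (hg : SubGaussianGrowth g) :
    SubGaussianGrowth fun x => f x * g x := by
  refine ⟨hf.measurable.mul hg.measurable, fun ε hε => ?_⟩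
  obtain ⟨C, hC0, hC⟩ := hf.exists_nonneg_bound (half_pos hε)
  obtain ⟨D, -, hD⟩ := hg.exists_nonneg_bound (half_pos hε)
  refine ⟨C * D, fun x => ?_⟩
  calc |f x * g x| ≤ (C * Real.exp (ε / 2 * x ^ 2)) * (D * Real.exp (ε / 2 * x ^ 2)) := by
        rw [abs_mul]
        gcongr
        exacts [hC x, hD x]
    _ = C * D * Real.exp (ε * x ^ 2) := by
        rw [mul_mul_mul_comm, ← Real.exp_add]
        ring_nf

theorem const_mul (hf : SubGaussianGrowth f) (c : ℝ) : SubGaussianGrowth fun x => c * f x := by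
  refine ⟨hf.measurable.const_mul c, fun ε hε => ?_⟩
  obtain ⟨C, hC⟩ := hf.exists_bound ε hε
  refine ⟨|c| * C, fun x => ?_⟩
  rw [abs_mul, mul_assoc]
  gcongr
  exact hC x

theorem pow (p : ℕ) : SubGaussianGrowth fun x => x ^ p := by
  refine ⟨measurable_id.pow_const p, fun ε hε =>
    ⟨p.factorial * Real.exp (1 / (4 * ε)), fun x => ?_⟩⟩
  have hpow : |x| ^ p ≤ p.factorial * Real.exp |x| := by
    have := Real.pow_div_factorial_le_exp |x| (abs_nonneg x) p
    rwa [div_le_iff₀ (by positivity), mul_comm] at this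
  have hsq : |x| ≤ 1 / (4 * ε) + ε * x ^ 2 := by
    rw [← sq_abs, ← sub_nonneg]
    have : 1 / (4 * ε) + ε * |x| ^ 2 - |x| = (2 * ε * |x| - 1) ^ 2 / (4 * ε) := by
      field_simp
      ring
    rw [this]
    positivity
  calc |x ^ p| ≤ p.factorial * Real.exp |x| := (abs_pow x p).trans_le hpow
    _ ≤ p.factorial * Real.exp (1 / (4 * ε) + ε * x ^ 2) := by gcongr
    _ = p.factorial * Real.exp (1 / (4 * ε)) * Real.exp (ε * x ^ 2) := by
        rw [Real.exp_add, mul_assoc]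

theorem of_moderateGrowth (hf : ModerateGrowth f) (hc : Continuous f) : SubGaussianGrowth f := by
  refine ⟨hc.measurable, fun ε hε => ?_⟩
  obtain ⟨A, b, α, hα, hA⟩ := hf
  have hA0 : 0 ≤ A := nonneg_of_mul_nonneg_left ((abs_nonneg _).trans (hA 0)) (Real.exp_pos _)
  have hlim : Tendsto (fun y : ℝ => b * y ^ (-(2 - α))) atTop (nhds 0) := by
    simpa using (tendsto_rpow_neg_atTop (by linarith : 0 < 2 - α)).const_mul b
  obtain ⟨R, hR⟩ := eventually_atTop.1 ((hlim.eventually_le_const hε).and (eventually_gt_atTop 0))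
  obtain ⟨D, hD⟩ := (isCompact_Icc (a := -R) (b := R)).exists_bound_of_continuousOn hc.continuousOn
  refine ⟨max A D, fun x => ?_⟩
  rcases le_or_gt |x| R with hx | hx
  · have hDx : |f x| ≤ max A D := (hD x (abs_le.1 hx)).trans (le_max_right _ _)
    exact hDx.trans (le_mul_of_one_le_right (hA0.trans (le_max_left _ _))
      (Real.one_le_exp (by positivity)))
  · obtain ⟨hb, hx0⟩ := hR |x| hx.le
    have hexponent : b * |x| ^ α ≤ ε * x ^ 2 := by
      have : |x| ^ α = |x| ^ (-(2 - α)) * x ^ 2 := by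
        rw [← sq_abs, ← Real.rpow_two, ← Real.rpow_add hx0, neg_sub, sub_add_cancel]
      rw [this, ← mul_assoc]
      gcongr
    calc |f x| ≤ A * Real.exp (b * |x| ^ α) := hA x
      _ ≤ max A D * Real.exp (ε * x ^ 2) := by
        gcongr
        exact le_max_left _ _

end SubGaussianGrowth

/-- The test functions of the Gaussian calculus below: smooth functions all of whose derivatives
are of sub-Gaussian growth. -/
structure SmoothSubGaussian (f : ℝ → ℝ) : Prop where
  contDiff : ContDiff ℝ (⊤ : ℕ∞) f
  growth_iteratedDeriv : ∀ k : ℕ, SubGaussianGrowth (iteratedDeriv k f)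

namespace SmoothSubGaussian

variable {f : ℝ → ℝ}

theorem of_moderateGrowth (hf : ContDiff ℝ (⊤ : ℕ∞) f)
    (hgrowth : ∀ k : ℕ, ModerateGrowth (iteratedDeriv k f)) : SmoothSubGaussian f where
  contDiff := hf
  growth_iteratedDeriv k := .of_moderateGrowth (hgrowth k)
    (hf.continuous_iteratedDeriv k (mod_cast le_top))

theorem pow (p : ℕ) : SmoothSubGaussian fun x => x ^ p where
  contDiff := contDiff_id.pow p
  growth_iteratedDeriv k := by
    rw [show iteratedDeriv k (fun x : ℝ => x ^ p) =
        fun x : ℝ => (p.descFactorial k : ℝ) * x ^ (p - k) from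
      funext fun x => iteratedDeriv_pow p k]
    exact (SubGaussianGrowth.pow _).const_mul _

theorem growth (hf : SmoothSubGaussian f) : SubGaussianGrowth f := by
  simpa only [iteratedDeriv_zero] using hf.growth_iteratedDeriv 0

theorem differentiable (hf : SmoothSubGaussian f) : Differentiable ℝ f :=
  hf.contDiff.differentiable (by simp)

theorem deriv (hf : SmoothSubGaussian f) : SmoothSubGaussian (deriv f) where
  contDiff := (contDiff_infty_iff_deriv.1 hf.contDiff).2
  growth_iteratedDeriv k := by
    simpa only [iteratedDeriv_succ'] using hf.growth_iteratedDeriv (k + 1)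

theorem iteratedDeriv (hf : SmoothSubGaussian f) (k : ℕ) :
    SmoothSubGaussian (iteratedDeriv k f) := by
  induction k with
  | zero => simpa only [iteratedDeriv_zero] using hf
  | succ k ih => simpa only [iteratedDeriv_succ] using ih.deriv

end SmoothSubGaussian

section MixedMoments

open Asymptotics Finset Function

variable {Ω ι : Type*} [MeasurableSpace Ω] {P : Measure Ω}

/-- `X` is a centered Gaussian vector whose components have variance at most `V`. The estimates on
mixed moments below are uniform over such vectors. -/
structure IsCenteredGaussian [Fintype ι] (P : Measure Ω) (V : ℝ) (X : ι → Ω → ℝ) : Prop where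
  hasGaussianLaw : HasGaussianLaw (fun ω i => X i ω) P
  integral_eq_zero : ∀ i, ∫ ω, X i ω ∂P = 0
  variance_le : ∀ i, Var[X i; P] ≤ V

/-- The mixed moment `E[∏ i, f i (X i)]`. -/
noncomputable def mixedMoment [Fintype ι] (P : Measure Ω) (f : ι → ℝ → ℝ) (X : ι → Ω → ℝ) : ℝ :=
  ∫ ω, ∏ i, f i (X i ω) ∂P

theorem forall_update_of_forall {α : Type*} [DecidableEq ι] {p : α → Prop} {f : ι → α}
    (hf : ∀ i, p (f i)) (k : ι) {a : α} (ha : p a) (i : ι) : p (update f k a i) :=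
  (forall_update_iff f fun _ => p).2 ⟨ha, fun j _ => hf j⟩ i

theorem isBigO_sum_mul {α : Type*} {l : Filter α} {s : Finset ι} {c M R : ι → α → ℝ}
    (h : ∀ k ∈ s, M k =O[l] R k) :
    (fun x => ∑ k ∈ s, c k x * M k x) =O[l] fun x => ∑ k ∈ s, |c k x| * |R k x| := by
  refine IsBigO.fun_sum fun k hk => ((isBigO_refl (c k) l).mul (h k hk)).trans ?_
  refine IsBigO.of_norm_le fun x => ?_
  rw [norm_mul]
  exact single_le_sum (f := fun k => |c k x| * |R k x|) (fun k _ => by positivity) hk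

variable [Fintype ι]

theorem exp_sum_le_sum_exp_card_mul [Nonempty ι] (y : ι → ℝ) :
    Real.exp (∑ i, y i) ≤ ∑ i, Real.exp (Fintype.card ι * y i) := by
  obtain ⟨i, -, hi⟩ := exists_max_image univ y univ_nonempty
  calc Real.exp (∑ j, y j) ≤ Real.exp (Fintype.card ι * y i) := by
        gcongr
        simpa using sum_le_card_nsmul univ y (y i) hi
    _ ≤ _ := single_le_sum (f := fun j => Real.exp (Fintype.card ι * y j))
        (fun j _ => (Real.exp_pos _).le) (mem_univ i)

theorem exists_abs_prod_le_sum_exp [Nonempty ι] {f : ι → ℝ → ℝ}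
    (hf : ∀ i, SubGaussianGrowth (f i)) {ε : ℝ} (hε : 0 < ε) :
    ∃ C, 0 ≤ C ∧ ∀ x : ι → ℝ, |∏ i, f i (x i)| ≤ C * ∑ i, Real.exp (ε * x i ^ 2) := by
  have hcard : (0 : ℝ) < Fintype.card ι := mod_cast Fintype.card_pos
  choose C hC0 hC using fun i => (hf i).exists_nonneg_bound (div_pos hε hcard)
  refine ⟨∏ i, C i, prod_nonneg fun i _ => hC0 i, fun x => ?_⟩
  calc |∏ i, f i (x i)| ≤ ∏ i, C i * Real.exp (ε / Fintype.card ι * x i ^ 2) := by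
        rw [abs_prod]
        gcongr with i
        exact hC i _
    _ = (∏ i, C i) * Real.exp (∑ i, ε / Fintype.card ι * x i ^ 2) := by
        rw [prod_mul_distrib, Real.exp_sum]
    _ ≤ (∏ i, C i) * ∑ i, Real.exp (Fintype.card ι * (ε / Fintype.card ι * x i ^ 2)) := by
        gcongr
        · exact prod_nonneg fun i _ => hC0 i
        · exact exp_sum_le_sum_exp_card_mul _
    _ = (∏ i, C i) * ∑ i, Real.exp (ε * x i ^ 2) := by
        simp only [← mul_assoc, mul_div_cancel₀ ε hcard.ne']

namespace IsCenteredGaussian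

variable {V : ℝ} {X : ι → Ω → ℝ} {f : ι → ℝ → ℝ}

theorem mul_variance_le (hX : IsCenteredGaussian P V X) (hV : 0 < V) (i : ι) :
    1 / (4 * V) * Var[X i; P] ≤ 1 / 4 := by
  calc 1 / (4 * V) * Var[X i; P] ≤ 1 / (4 * V) * V := by gcongr; exact hX.variance_le i
    _ = 1 / 4 := by field_simp

theorem integrable_sum_exp (hX : IsCenteredGaussian P V X) (hV : 0 < V) :
    Integrable (fun ω => ∑ i, Real.exp (1 / (4 * V) * X i ω ^ 2)) P :=
  integrable_finsetSum _ fun i _ => integrable_exp_mul_sq (hX.hasGaussianLaw.eval i)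
    (hX.integral_eq_zero i) (hX.mul_variance_le hV i)

theorem integral_sum_exp_le (hX : IsCenteredGaussian P V X) (hV : 0 < V) :
    ∫ ω, ∑ i, Real.exp (1 / (4 * V) * X i ω ^ 2) ∂P ≤ Fintype.card ι * √2 := by
  rw [integral_finsetSum _ fun i _ => integrable_exp_mul_sq (hX.hasGaussianLaw.eval i)
    (hX.integral_eq_zero i) (hX.mul_variance_le hV i)]
  simpa using sum_le_card_nsmul univ _ _ fun i _ => integral_exp_mul_sq_le
    (hX.hasGaussianLaw.eval i) (hX.integral_eq_zero i) (hX.mul_variance_le hV i)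

variable [Nonempty ι]

theorem integrable_prod (hX : IsCenteredGaussian P V X) (hV : 0 < V)
    (hf : ∀ i, SubGaussianGrowth (f i)) : Integrable (fun ω => ∏ i, f i (X i ω)) P := by
  obtain ⟨C, -, hC⟩ := exists_abs_prod_le_sum_exp hf (ε := 1 / (4 * V)) (by positivity)
  refine ((hX.integrable_sum_exp hV).const_mul C).mono' ?_ (ae_of_all _ fun ω => hC _)
  exact (Finset.aemeasurable_fun_prod _ fun i _ => (hf i).measurable.comp_aemeasurable
    (hX.hasGaussianLaw.eval i).aemeasurable).aestronglyMeasurable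

end IsCenteredGaussian

theorem mixedMoment_isBigO_one [Nonempty ι] {V : ℝ} (hV : 0 < V) {f : ι → ℝ → ℝ}
    (hf : ∀ i, SubGaussianGrowth (f i)) :
    mixedMoment P f =O[𝓟 {X | IsCenteredGaussian P V X}] fun _ => (1 : ℝ) := by
  obtain ⟨C, hC0, hC⟩ := exists_abs_prod_le_sum_exp hf (ε := 1 / (4 * V)) (by positivity)
  refine isBigO_principal.2 ⟨C * (Fintype.card ι * √2), fun X hX => ?_⟩
  rw [norm_one, mul_one]
  calc ‖mixedMoment P f X‖
      ≤ ∫ ω, C * ∑ i, Real.exp (1 / (4 * V) * X i ω ^ 2) ∂P :=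
        norm_integral_le_of_norm_le ((hX.integrable_sum_exp hV).const_mul C)
          (ae_of_all _ fun ω => hC _)
    _ ≤ C * (Fintype.card ι * √2) := by
        rw [integral_const_mul]
        gcongr
        exact hX.integral_sum_exp_le hV

theorem variance_isBigO_one {V : ℝ} (i : ι) :
    (fun X : ι → Ω → ℝ => Var[X i; P]) =O[𝓟 {X | IsCenteredGaussian P V X}] fun _ => (1 : ℝ) :=
  isBigO_principal.2 ⟨V, fun X hX => by
    rw [Real.norm_of_nonneg (variance_nonneg _ _), norm_one, mul_one]
    exact hX.variance_le i⟩

variable [DecidableEq ι]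

theorem prod_update_apply (f : ι → ℝ → ℝ) (i : ι) (φ : ℝ → ℝ) (x : ι → ℝ) :
    ∏ j, update f i φ j (x j) = φ (x i) * ∏ j ∈ univ.erase i, f j (x j) := by
  rw [← mul_prod_erase _ _ (mem_univ i), update_self]
  exact congrArg _ (prod_congr rfl fun j hj => by rw [update_of_ne (ne_of_mem_erase hj)])

theorem mixedMoment_update_const_mul (f : ι → ℝ → ℝ) (i : ι) (c : ℝ) (φ : ℝ → ℝ)
    (X : ι → Ω → ℝ) : mixedMoment P (update f i fun x => c * φ x) X =
      c * mixedMoment P (update f i φ) X := by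
  simp only [mixedMoment, prod_update_apply, mul_assoc, integral_const_mul]

theorem fderiv_prod_apply {f : ι → ℝ → ℝ} (hf : ∀ i, Differentiable ℝ (f i)) (x c : ι → ℝ) :
    fderiv ℝ (fun x : ι → ℝ => ∏ i, f i (x i)) x c =
      ∑ k, c k * ∏ j, update f k (deriv (f k)) j (x j) := by
  have hcoord k : HasFDerivAt (fun x : ι → ℝ => f k (x k))
      (deriv (f k) (x k) • ContinuousLinearMap.proj (R := ℝ) (φ := fun _ : ι => ℝ) k) x :=
    (hf k (x k)).hasDerivAt.comp_hasFDerivAt x (hasFDerivAt_apply k x)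
  rw [(HasFDerivAt.finsetProd fun k _ => hcoord k).fderiv]
  simp only [prod_update_apply, _root_.sum_apply, _root_.smul_apply,
    ContinuousLinearMap.proj_apply, smul_eq_mul]
  exact sum_congr rfl fun k _ => by ring

variable {V : ℝ} {X : ι → Ω → ℝ} {f : ι → ℝ → ℝ}

theorem integral_mul_prod (hX : IsCenteredGaussian P V X) (hV : 0 < V)
    (hf : ∀ i, SmoothSubGaussian (f i)) (i : ι) :
    ∫ ω, X i ω * ∏ j, f j (X j ω) ∂P =
      ∑ k, cov[X i, X k; P] * mixedMoment P (update f k (deriv (f k))) X := by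
  have : Nonempty ι := ⟨i⟩
  have hgrowth j : SubGaussianGrowth (f j) := (hf j).growth
  have hderiv k : Integrable (fun ω => ∏ j, update f k (deriv (f k)) j (X j ω)) P :=
    hX.integrable_prod hV (forall_update_of_forall hgrowth k (hf k).deriv.growth)
  have hmul : Integrable (fun ω => X i ω * ∏ j, f j (X j ω)) P := by
    have := hX.integrable_prod hV
      (forall_update_of_forall hgrowth i ((SubGaussianGrowth.pow 1).mul (hgrowth i)))
    refine this.congr (ae_of_all _ fun ω => ?_)
    beta_reduce
    rw [prod_update_apply _ _ _ (X · ω),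
      ← mul_prod_erase univ (fun j => f j (X j ω)) (mem_univ i), pow_one, mul_assoc]
  have hdiff : Differentiable ℝ fun x : ι → ℝ => ∏ j, f j (x j) := by
    have hd j := (hf j).differentiable
    fun_prop
  have hfderiv ω := fderiv_prod_apply (fun j => (hf j).differentiable) (X · ω)
    fun j => cov[X i, X j; P]
  rw [integral_mul_eq_integral_fderiv hX.hasGaussianLaw (hX.integral_eq_zero i) hdiff
    (hX.integrable_prod hV hgrowth) hmul]
  · simp only [hfderiv, integral_finsetSum _ fun k _ => (hderiv k).const_mul _,
      integral_const_mul, mixedMoment]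
  · simp only [hfderiv]
    exact integrable_finsetSum _ fun k _ => (hderiv k).const_mul _

theorem mixedMoment_eq_of_pow_succ (hX : IsCenteredGaussian P V X) (hV : 0 < V)
    (hf : ∀ i, SmoothSubGaussian (f i)) {i : ι} {p : ℕ} (hi : f i = fun x => x ^ (p + 1)) :
    mixedMoment P f X = p * Var[X i; P] * mixedMoment P (update f i fun x => x ^ (p - 1)) X +
      ∑ k ∈ univ.erase i, cov[X i, X k; P] *
        mixedMoment P (update (update f i fun x => x ^ p) k (deriv (f k))) X := by
  set g := update f i fun x => x ^ p with hg
  have hfg : mixedMoment P f X = ∫ ω, X i ω * ∏ j, g j (X j ω) ∂P := by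
    refine integral_congr_ae (ae_of_all _ fun ω => ?_)
    beta_reduce
    rw [hg, prod_update_apply _ _ _ (X · ω),
      ← mul_prod_erase univ (fun j => f j (X j ω)) (mem_univ i), hi]
    ring
  have hgi : update g i (deriv (g i)) = update f i fun x => p * x ^ (p - 1) := by
    rw [hg, update_self, update_idem]
    exact congrArg _ (funext fun x => deriv_pow_field p)
  rw [hfg, integral_mul_prod hX hV (forall_update_of_forall hf i (.pow p)) i,
    ← add_sum_erase _ _ (mem_univ i), hgi, mixedMoment_update_const_mul,
    covariance_self (hX.hasGaussianLaw.eval i).aemeasurable]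
  congr 1
  · ring
  · refine sum_congr rfl fun k hk => ?_
    rw [hg, update_of_ne (ne_of_mem_erase hk)]

theorem mixedMoment_isBigO_of_odd_pow (hV : 0 < V) (hf : ∀ i, SmoothSubGaussian (f i)) {i : ι}
    {p : ℕ} (hp : Odd p) (hi : f i = fun x => x ^ p) {R : ι → (ι → Ω → ℝ) → ℝ}
    (hR : ∀ m, ∀ k ≠ i, mixedMoment P (update (update f i fun x => x ^ m) k (deriv (f k)))
      =O[𝓟 {X | IsCenteredGaussian P V X}] R k) :
    mixedMoment P f =O[𝓟 {X | IsCenteredGaussian P V X}]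
      fun X => ∑ k ∈ univ.erase i, |cov[X i, X k; P]| * |R k X| := by
  obtain ⟨m, rfl⟩ := hp
  induction m using Nat.strong_induction_on generalizing f with | h m ih => ?_
  have hrec : mixedMoment P f =ᶠ[𝓟 {X | IsCenteredGaussian P V X}] _ :=
    eventually_principal.2 fun X hX => mixedMoment_eq_of_pow_succ hX hV hf hi
  refine IsBigO.congr' (.add ?_ ?_) hrec.symm .rfl
  · rcases m with - | m
    · simpa using isBigO_zero _ _
    · have hlower := ih m m.lt_succ_self (forall_update_of_forall hf i (.pow _))
        (fun r k hk => by
          rw [update_idem, update_of_ne hk]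
          exact hR r k hk) (update_self i _ f)
      exact (((variance_isBigO_one i).const_mul_left _).mul hlower).congr_right fun _ => one_mul _
  · exact isBigO_sum_mul fun k hk => hR _ k (ne_of_mem_erase hk)

theorem mixedMoment_isBigO_sum_covariance (hV : 0 < V) (hf : ∀ i, SmoothSubGaussian (f i))
    {i : ι} {p : ℕ} (hp : Odd p) (hi : f i = fun x => x ^ p) :
    mixedMoment P f =O[𝓟 {X | IsCenteredGaussian P V X}]
      fun X => ∑ k ∈ univ.erase i, |cov[X i, X k; P]| := by
  have : Nonempty ι := ⟨i⟩
  simpa using mixedMoment_isBigO_of_odd_pow hV hf hp hi (R := fun _ _ => 1) fun m k _ =>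
    mixedMoment_isBigO_one hV (forall_update_of_forall
      (forall_update_of_forall (fun j => (hf j).growth) i (.pow m)) k (hf k).deriv.growth)

theorem mixedMoment_isBigO_of_odd_pow_of_odd_pow (hV : 0 < V)
    (hf : ∀ i, SmoothSubGaussian (f i)) {i j : ι} (hij : j ≠ i) {p q : ℕ}
    (hp : Odd p) (hi : f i = fun x => x ^ p) (hq : Odd q) (hj : f j = fun x => x ^ q) :
    mixedMoment P f =O[𝓟 {X | IsCenteredGaussian P V X}] fun X => |cov[X i, X j; P]| +
      ∑ k ∈ (univ.erase i).erase j, |cov[X i, X k; P]| *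
        ∑ l ∈ univ.erase j, |cov[X j, X l; P]| := by
  have : Nonempty ι := ⟨i⟩
  have hsmooth (m k) (l : ι) :
      SmoothSubGaussian (update (update f i fun x => x ^ m) k (deriv (f k)) l) :=
    forall_update_of_forall (forall_update_of_forall hf i (.pow m)) k (hf k).deriv l
  have h := mixedMoment_isBigO_of_odd_pow (P := P) hV hf hp hi
    (R := fun k X => if k = j then 1 else ∑ l ∈ univ.erase j, |cov[X j, X l; P]|) fun m k _ => ?_
  · refine h.congr_right fun X => ?_
    rw [← add_sum_erase _ _ (mem_erase.2 ⟨hij, mem_univ j⟩), if_pos rfl, abs_one, mul_one]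
    refine congrArg _ (sum_congr rfl fun k hk => ?_)
    rw [if_neg (ne_of_mem_erase hk), abs_sum_of_nonneg' fun _ => abs_nonneg _]
  · split_ifs with hkj
    · exact mixedMoment_isBigO_one hV fun l => (hsmooth m k l).growth
    · exact mixedMoment_isBigO_sum_covariance hV (hsmooth m k) hq (by
        rw [update_of_ne (Ne.symm hkj), update_of_ne hij, hj])

end MixedMoments

section Simpson

open Finset Set

theorem exists_eq_taylor_add {f : ℝ → ℝ} {n : ℕ} (hf : ContDiff ℝ (n + 1) f) {m x K : ℝ}
    (hK : ∀ y ∈ uIcc m x, |iteratedDeriv (n + 1) f y| ≤ K) :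
    ∃ E, f x = ∑ k ∈ range (n + 1), iteratedDeriv k f m / k.factorial * (x - m) ^ k + E ∧
      |E| ≤ K * |x - m| ^ (n + 1) := by
  have : 0 ≤ K := (abs_nonneg _).trans (hK m left_mem_uIcc)
  rcases eq_or_ne m x with rfl | hx
  · exact ⟨0, by simp [sum_range_succ'], by simp⟩
  obtain ⟨y, hy, h⟩ := taylor_mean_remainder_lagrange_iteratedDeriv hx hf.contDiffOn
  have hpoly : taylorWithinEval f n (uIcc m x) m x =
      ∑ k ∈ range (n + 1), iteratedDeriv k f m / k.factorial * (x - m) ^ k := by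
    rw [taylor_within_apply]
    refine sum_congr rfl fun k hk => ?_
    rw [iteratedDerivWithin_eq_iteratedDeriv (uniqueDiffOn_uIcc hx)
      (hf.contDiffAt.of_le (mod_cast (mem_range.1 hk).le)) left_mem_uIcc, smul_eq_mul]
    ring
  refine ⟨_, sub_eq_iff_eq_add'.1 (hpoly ▸ h), ?_⟩
  rw [abs_div, abs_mul, abs_pow, Nat.abs_cast]
  refine (div_le_self (by positivity) (mod_cast Nat.one_le_iff_ne_zero.2
    (Nat.factorial_ne_zero _))).trans ?_
  gcongr
  exact hK y (uIoo_subset_uIcc_self hy)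

/-- The weight of the `k`-th derivative at the midpoint, `k` odd, in the Taylor expansion of the
error of one step of Simpson's rule. It vanishes for `k = 3`. -/
noncomputable def simpsonCoeff (k : ℕ) : ℝ := (k - 3) / (3 * 2 ^ (k - 1) * k.factorial)

theorem abs_simpson_error_centered_le {g : ℝ → ℝ} (hg : ContDiff ℝ 10 g) {m s K : ℝ}
    (hK : ∀ x ∈ uIcc (m - s) (m + s), |iteratedDeriv 10 g x| ≤ K) :
    |1 / 6 * (deriv g (m - s) + 4 * deriv g m + deriv g (m + s)) * (2 * s) -
      (g (m + s) - g (m - s)) -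
      ∑ k ∈ {5, 7, 9}, simpsonCoeff k * (iteratedDeriv k g m * (2 * s) ^ k)| ≤
      K * |2 * s| ^ 10 := by
  have hmid : m ∈ uIcc (m - s) (m + s) := by
    rcases le_total 0 s with hs | hs
    · exact Icc_subset_uIcc ⟨by linarith, by linarith⟩
    · exact Icc_subset_uIcc' ⟨by linarith, by linarith⟩
  have hg' : ContDiff ℝ 9 (deriv g) := (contDiff_succ_iff_deriv (n := 9)).1 hg |>.2.2
  have taylor {x} (hx : x ∈ uIcc (m - s) (m + s)) := exists_eq_taylor_add (n := 9) (x := x) hg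
    fun y hy => hK y (uIcc_subset_uIcc hmid hx hy)
  have taylor' {x} (hx : x ∈ uIcc (m - s) (m + s)) := exists_eq_taylor_add (n := 8) (x := x) hg'
    fun y hy => by
      rw [← iteratedDeriv_succ']
      exact hK y (uIcc_subset_uIcc hmid hx hy)
  obtain ⟨E₁, h₁, b₁⟩ := taylor left_mem_uIcc
  obtain ⟨E₂, h₂, b₂⟩ := taylor right_mem_uIcc
  obtain ⟨E₃, h₃, b₃⟩ := taylor' left_mem_uIcc
  obtain ⟨E₄, h₄, b₄⟩ := taylor' right_mem_uIcc
  rw [sub_sub_cancel_left] at h₁ h₃ b₁ b₃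
  rw [add_sub_cancel_left] at h₂ h₄ b₂ b₄
  rw [abs_neg] at b₁ b₃
  have herror : 1 / 6 * (deriv g (m - s) + 4 * deriv g m + deriv g (m + s)) * (2 * s) -
      (g (m + s) - g (m - s)) -
      ∑ k ∈ {5, 7, 9}, simpsonCoeff k * (iteratedDeriv k g m * (2 * s) ^ k) =
      1 / 3 * s * (E₃ + E₄) - (E₂ - E₁) := by
    rw [h₁, h₂, h₃, h₄]
    simp [sum_range_succ, ← iteratedDeriv_succ', simpsonCoeff, Nat.factorial]
    ring
  have : 0 ≤ K * |s| ^ 10 := mul_nonneg ((abs_nonneg _).trans (hK m hmid)) (by positivity)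
  rw [herror, abs_mul, mul_pow, abs_two]
  calc |1 / 3 * s * (E₃ + E₄) - (E₂ - E₁)|
      ≤ 1 / 3 * |s| * (|E₃| + |E₄|) + (|E₂| + |E₁|) := by
        grw [abs_sub, abs_sub E₂, abs_mul, abs_mul, abs_add_le]
        norm_num
    _ ≤ 1 / 3 * |s| * (K * |s| ^ 9 + K * |s| ^ 9) + (K * |s| ^ 10 + K * |s| ^ 10) := by gcongr
    _ ≤ K * (2 ^ 10 * |s| ^ 10) := by linarith

theorem abs_simpson_error_le {g : ℝ → ℝ} (hg : ContDiff ℝ 10 g) {a b K : ℝ}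
    (hK : ∀ x ∈ uIcc a b, |iteratedDeriv 10 g x| ≤ K) :
    |1 / 6 * (deriv g a + 4 * deriv g (1 / 2 * (a + b)) + deriv g b) * (b - a) - (g b - g a) -
      ∑ k ∈ {5, 7, 9}, simpsonCoeff k * (iteratedDeriv k g (1 / 2 * (a + b)) * (b - a) ^ k)| ≤
      K * |b - a| ^ 10 := by
  have ha : 1 / 2 * (a + b) - 1 / 2 * (b - a) = a := by ring
  have hb : 1 / 2 * (a + b) + 1 / 2 * (b - a) = b := by ring
  have hs : 2 * (1 / 2 * (b - a)) = b - a := by ring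
  have h := abs_simpson_error_centered_le hg (m := 1 / 2 * (a + b)) (s := 1 / 2 * (b - a)) (K := K)
  rw [ha, hb, hs] at h
  exact h hK

end Simpson

section Pathwise

open Finset Set

/-- The sum of `f` at the midpoints of the first `N` steps of `x`, weighted by the `p`-th powers of
the steps. -/
noncomputable def midpointSum (f : ℝ → ℝ) (p : ℕ) (x : ℕ → ℝ) (N : ℕ) : ℝ :=
  ∑ j ∈ range N, f (1 / 2 * (x j + x (j + 1))) * (x (j + 1) - x j) ^ p

/-- The `p`-th power of the increment from `a` to `b`, weighted by a bound for all functions of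
sub-Gaussian growth between `a` and `b`. -/
noncomputable def weightedIncrement (ε : ℝ) (p : ℕ) (a b : ℝ) : ℝ :=
  (Real.exp (ε * a ^ 2) + Real.exp (ε * b ^ 2)) * |b - a| ^ p

theorem weightedIncrement_nonneg (ε : ℝ) (p : ℕ) (a b : ℝ) : 0 ≤ weightedIncrement ε p a b := by
  unfold weightedIncrement
  positivity

theorem exp_mul_sq_le_of_mem_uIcc {ε : ℝ} (hε : 0 ≤ ε) {a b x : ℝ} (hx : x ∈ Set.uIcc a b) :
    Real.exp (ε * x ^ 2) ≤ Real.exp (ε * a ^ 2) + Real.exp (ε * b ^ 2) := by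
  have hconvex : ConvexOn ℝ univ fun x : ℝ => x ^ 2 := even_two.convexOn_pow
  have hmax : x ^ 2 ≤ max (a ^ 2) (b ^ 2) :=
    hconvex.le_max_of_mem_segment (mem_univ a) (mem_univ b) (segment_eq_uIcc a b ▸ hx)
  rcases le_max_iff.1 hmax with h | h
  · exact le_add_of_le_of_nonneg (by gcongr) (Real.exp_pos _).le
  · exact le_add_of_nonneg_of_le (Real.exp_pos _).le (by gcongr)

theorem SubGaussianGrowth.exists_abs_le_of_mem_uIcc {f : ℝ → ℝ} (hf : SubGaussianGrowth f) {ε : ℝ}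
    (hε : 0 < ε) : ∃ C, 0 ≤ C ∧ ∀ a b, ∀ x ∈ Set.uIcc a b,
      |f x| ≤ C * (Real.exp (ε * a ^ 2) + Real.exp (ε * b ^ 2)) := by
  obtain ⟨C, hC0, hC⟩ := hf.exists_nonneg_bound hε
  refine ⟨C, hC0, fun a b x hx => (hC x).trans ?_⟩
  gcongr
  exact exp_mul_sq_le_of_mem_uIcc hε.le hx

theorem exists_abs_midpointSum_le {f : ℝ → ℝ} (hf : SubGaussianGrowth f) {ε : ℝ} (hε : 0 < ε)
    (p : ℕ) : ∃ C, ∀ x N,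
      |midpointSum f p x N| ≤ C * ∑ j ∈ range N, weightedIncrement ε p (x j) (x (j + 1)) := by
  obtain ⟨C, -, hC⟩ := hf.exists_abs_le_of_mem_uIcc hε
  refine ⟨C, fun x N => (abs_sum_le_sum_abs _ _).trans ?_⟩
  rw [mul_sum]
  refine sum_le_sum fun j _ => ?_
  have hmid : 1 / 2 * (x j + x (j + 1)) ∈ Set.uIcc (x j) (x (j + 1)) := by
    rw [← segment_eq_uIcc]
    exact ⟨1 / 2, 1 / 2, by norm_num, by norm_num, by norm_num, by simp only [smul_eq_mul]; ring⟩
  rw [abs_mul, abs_pow, weightedIncrement, ← mul_assoc]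
  gcongr
  exact hC _ _ _ hmid

theorem exists_abs_sub_le_weightedIncrement {g : ℝ → ℝ} (hg : SmoothSubGaussian g) {ε : ℝ}
    (hε : 0 < ε) : ∃ C, ∀ a b, |g b - g a| ≤ C * weightedIncrement ε 1 a b := by
  obtain ⟨C, -, hC⟩ := hg.deriv.growth.exists_abs_le_of_mem_uIcc hε
  refine ⟨C, fun a b => ?_⟩
  rw [weightedIncrement, pow_one, ← mul_assoc]
  exact (convex_uIcc a b).norm_image_sub_le_of_norm_deriv_le
    (fun x _ => hg.differentiable x) (hC a b) left_mem_uIcc right_mem_uIcc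

theorem exists_abs_simpson_sub_midpointSum_le {g : ℝ → ℝ} (hg : SmoothSubGaussian g) {ε : ℝ}
    (hε : 0 < ε) : ∃ C, ∀ (x : ℕ → ℝ) N,
      |∑ j ∈ range N, 1 / 6 * (deriv g (x j) + 4 * deriv g (1 / 2 * (x j + x (j + 1))) +
          deriv g (x (j + 1))) * (x (j + 1) - x j) - (g (x N) - g (x 0)) -
        ∑ k ∈ {5, 7, 9}, simpsonCoeff k * midpointSum (iteratedDeriv k g) k x N| ≤
      C * ∑ j ∈ range N, weightedIncrement ε 10 (x j) (x (j + 1)) := by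
  obtain ⟨C, -, hC⟩ := (hg.growth_iteratedDeriv 10).exists_abs_le_of_mem_uIcc hε
  refine ⟨C, fun x N => ?_⟩
  simp only [midpointSum, mul_sum]
  rw [← sum_range_sub (fun j => g (x j)), sum_comm, ← sum_sub_distrib, ← sum_sub_distrib]
  refine (abs_sum_le_sum_abs _ _).trans (sum_le_sum fun j _ => ?_)
  rw [weightedIncrement, ← mul_assoc]
  exact abs_simpson_error_le (contDiff_infty.1 hg.contDiff 10) (hC (x j) (x (j + 1)))

theorem exists_abs_simpsonSum_sub_le {g : ℝ → ℝ} (hg : SmoothSubGaussian g) {ε : ℝ} (hε : 0 < ε) :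
    ∃ C, ∀ (b : ℝ≥0 → ℝ) (t : ℝ≥0) (n : ℕ), |simpsonSum g b t n - (g (b t) - g (b 0))| ≤
      ∑ k ∈ {5, 7, 9}, |simpsonCoeff k| *
        |midpointSum (iteratedDeriv k g) k (fun j => b (j / n)) ⌊n * t⌋₊| +
      C * (∑ j ∈ range ⌊n * t⌋₊, weightedIncrement ε 10 (b (j / n)) (b ((j + 1 : ℕ) / n)) +
        weightedIncrement ε 1 (b (⌊n * t⌋₊ / n)) (b t)) := by
  obtain ⟨C, hC⟩ := exists_abs_simpson_sub_midpointSum_le hg hε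
  obtain ⟨D, hD⟩ := exists_abs_sub_le_weightedIncrement hg hε
  refine ⟨max C D, fun b t n => ?_⟩
  set N := ⌊n * t⌋₊
  set x : ℕ → ℝ := fun j => b (j / n)
  set M := ∑ k ∈ {5, 7, 9}, simpsonCoeff k * midpointSum (iteratedDeriv k g) k x N
  have hdecomp : simpsonSum g b t n - (g (b t) - g (b 0)) =
      (simpsonSum g b t n - (g (x N) - g (x 0)) - M) + M - (g (b t) - g (x N)) := by
    simp only [x, Nat.cast_zero, zero_div]
    ring
  have hM : |M| ≤ ∑ k ∈ {5, 7, 9}, |simpsonCoeff k| * |midpointSum (iteratedDeriv k g) k x N| := by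
    simpa only [abs_mul] using abs_sum_le_sum_abs
      (fun k => simpsonCoeff k * midpointSum (iteratedDeriv k g) k x N) {5, 7, 9}
  have hsimpson : |simpsonSum g b t n - (g (x N) - g (x 0)) - M| ≤
      C * ∑ j ∈ range N, weightedIncrement ε 10 (x j) (x (j + 1)) := by
    simpa only [simpsonSum, x, Nat.cast_succ] using hC x N
  calc |simpsonSum g b t n - (g (b t) - g (b 0))|
      ≤ |simpsonSum g b t n - (g (x N) - g (x 0)) - M| + |M| + |g (b t) - g (x N)| := by
        rw [hdecomp]
        exact (abs_sub _ _).trans (by gcongr; exact abs_add_le _ _)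
    _ ≤ max C D * ∑ j ∈ range N, weightedIncrement ε 10 (x j) (x (j + 1)) +
        ∑ k ∈ {5, 7, 9}, |simpsonCoeff k| * |midpointSum (iteratedDeriv k g) k x N| +
        max C D * weightedIncrement ε 1 (x N) (b t) := by
        refine add_le_add_three (hsimpson.trans ?_) hM ((hD _ _).trans ?_)
        · exact mul_le_mul_of_nonneg_right (le_max_left C D)
            (sum_nonneg fun _ _ => weightedIncrement_nonneg _ _ _ _)
        · exact mul_le_mul_of_nonneg_right (le_max_right C D)
            (weightedIncrement_nonneg _ _ _ _)
    _ = _ := by ring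

end Pathwise

section ConcaveVariogram

open Finset

/-- `v` is the variogram `v (dist j k) = E[(x j - x k) ^ 2]` of a sequence with stationary and
nonpositively correlated increments. -/
structure IsConcaveVariogram (v : ℕ → ℝ) : Prop where
  zero : v 0 = 0
  monotone : Monotone v
  antitone_sub : Antitone fun k => v (k + 1) - v k

/-- Variation of the variogram when the distance to `l` is measured from `j + 1` instead of `j`. -/
def distIncr (v : ℕ → ℝ) (j l : ℕ) : ℝ := v (Nat.dist (j + 1) l) - v (Nat.dist j l)

/-- The covariance of `x (j + 1) - x j` and `x l` when `x` starts at `0` and has variogram `v`. -/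
noncomputable def stepCov (v : ℕ → ℝ) (j l : ℕ) : ℝ := (v (j + 1) - v j - distIncr v j l) / 2

/-- The covariance of `x (j + 1) - x j` and `x (k + 1) - x k` when `x` has variogram `v`. -/
noncomputable def incrCov (v : ℕ → ℝ) (j k : ℕ) : ℝ := stepCov v j (k + 1) - stepCov v j k

/-- The covariance of `x (j + 1) - x j` and the midpoint of `x k` and `x (k + 1)` when `x` starts
at `0` and has variogram `v`. -/
noncomputable def midCov (v : ℕ → ℝ) (j k : ℕ) : ℝ := (stepCov v j k + stepCov v j (k + 1)) / 2

theorem distIncr_add_left (v : ℕ → ℝ) (l m : ℕ) : distIncr v (l + m) l = v (m + 1) - v m := by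
  simp only [distIncr, Nat.dist]
  congr 2 <;> omega

theorem distIncr_add_right (v : ℕ → ℝ) (j m : ℕ) :
    distIncr v j (j + (m + 1)) = -(v (m + 1) - v m) := by
  rw [neg_sub]
  simp only [distIncr, Nat.dist]
  congr 2 <;> omega

theorem incrCov_eq (v : ℕ → ℝ) (j k : ℕ) :
    incrCov v j k = (distIncr v j k - distIncr v j (k + 1)) / 2 := by
  rw [incrCov, stepCov, stepCov]
  ring

namespace IsConcaveVariogram

variable {v : ℕ → ℝ}

theorem nonneg (hv : IsConcaveVariogram v) (k : ℕ) : 0 ≤ v k := hv.zero ▸ hv.monotone k.zero_le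

theorem sub_nonneg (hv : IsConcaveVariogram v) (k : ℕ) : 0 ≤ v (k + 1) - v k :=
  _root_.sub_nonneg.2 (hv.monotone k.le_succ)

theorem sub_le (hv : IsConcaveVariogram v) (k : ℕ) : v (k + 1) - v k ≤ v 1 := by
  simpa [hv.zero] using hv.antitone_sub k.zero_le

theorem distIncr_nonneg (hv : IsConcaveVariogram v) {j l : ℕ} (h : l ≤ j) : 0 ≤ distIncr v j l := by
  obtain ⟨m, rfl⟩ := Nat.exists_eq_add_of_le h
  rw [distIncr_add_left]
  exact hv.sub_nonneg m

theorem distIncr_nonpos (hv : IsConcaveVariogram v) {j l : ℕ} (h : j < l) : distIncr v j l ≤ 0 := by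
  obtain ⟨m, rfl⟩ := Nat.exists_eq_add_of_lt h
  rw [add_assoc, distIncr_add_right]
  exact neg_nonpos.2 (hv.sub_nonneg m)

theorem abs_distIncr_le (hv : IsConcaveVariogram v) (j l : ℕ) : |distIncr v j l| ≤ v 1 := by
  rcases le_or_gt l j with h | h
  · obtain ⟨m, rfl⟩ := Nat.exists_eq_add_of_le h
    rw [distIncr_add_left, abs_of_nonneg (hv.sub_nonneg m)]
    exact hv.sub_le m
  · obtain ⟨m, rfl⟩ := Nat.exists_eq_add_of_lt h
    rw [add_assoc, distIncr_add_right, abs_neg, abs_of_nonneg (hv.sub_nonneg m)]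
    exact hv.sub_le m

theorem sum_abs_distIncr_le (hv : IsConcaveVariogram v) {l N : ℕ} (h : l ≤ N) :
    ∑ j ∈ range N, |distIncr v j l| ≤ 2 * v N := by
  have hleft : ∑ j ∈ range l, |distIncr v j l| = v l := by
    calc ∑ j ∈ range l, |distIncr v j l|
        = ∑ j ∈ range l, (v (Nat.dist j l) - v (Nat.dist (j + 1) l)) :=
          sum_congr rfl fun j hj => by
            rw [abs_of_nonpos (hv.distIncr_nonpos (mem_range.1 hj)), distIncr, neg_sub]
      _ = v l := by
        rw [sum_range_sub' fun j => v (Nat.dist j l), Nat.dist_self, hv.zero, sub_zero,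
          Nat.dist_eq_sub_of_le l.zero_le, Nat.sub_zero]
  obtain ⟨m, rfl⟩ := Nat.exists_eq_add_of_le h
  have hright : ∑ i ∈ range m, |distIncr v (l + i) l| = v m := by
    simp only [distIncr_add_left, abs_of_nonneg (hv.sub_nonneg _)]
    rw [sum_range_sub, hv.zero, sub_zero]
  rw [sum_range_add, hleft, hright, two_mul]
  exact add_le_add (hv.monotone (l.le_add_right m)) (hv.monotone (m.le_add_left l))

theorem incrCov_self (hv : IsConcaveVariogram v) (j : ℕ) : incrCov v j j = v 1 := by
  have hleft := distIncr_add_left v j 0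
  have hright := distIncr_add_right v j 0
  rw [add_zero, zero_add, hv.zero, sub_zero] at hleft
  rw [zero_add, hv.zero, sub_zero] at hright
  rw [incrCov_eq, hleft, hright]
  ring

theorem incrCov_nonpos (hv : IsConcaveVariogram v) {j k : ℕ} (h : k ≠ j) : incrCov v j k ≤ 0 := by
  rw [incrCov_eq]
  refine div_nonpos_of_nonpos_of_nonneg (sub_nonpos.2 ?_) zero_le_two
  rcases h.lt_or_gt with h | h
  · obtain ⟨m, rfl⟩ := Nat.exists_eq_add_of_lt h
    have hnear := distIncr_add_left v (k + 1) m
    rw [add_right_comm] at hnear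
    rw [hnear, add_assoc, distIncr_add_left]
    exact hv.antitone_sub m.le_succ
  · obtain ⟨m, rfl⟩ := Nat.exists_eq_add_of_lt h
    rw [add_assoc, add_assoc, distIncr_add_right, distIncr_add_right]
    exact neg_le_neg (hv.antitone_sub m.le_succ)

theorem sum_abs_incrCov_le (hv : IsConcaveVariogram v) {j N : ℕ} (hj : j < N) :
    ∑ k ∈ range N, |incrCov v j k| ≤ 2 * v 1 := by
  have habs k : |incrCov v j k| = -incrCov v j k + if j = k then 2 * v 1 else 0 := by
    split_ifs with h
    · rw [← h, hv.incrCov_self, abs_of_nonneg (hv.nonneg 1)]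
      ring
    · rw [abs_of_nonpos (hv.incrCov_nonpos (Ne.symm h)), add_zero]
  have htelescope : ∑ k ∈ range N, incrCov v j k = (distIncr v j 0 - distIncr v j N) / 2 := by
    simp only [incrCov_eq]
    rw [← sum_div, sum_range_sub']
  simp only [habs]
  rw [sum_add_distrib, sum_neg_distrib, htelescope, sum_ite_eq, if_pos (mem_range.2 hj)]
  linarith [hv.distIncr_nonneg j.zero_le, hv.distIncr_nonpos hj]

theorem abs_stepCov_le (hv : IsConcaveVariogram v) (j l : ℕ) :
    |stepCov v j l| ≤ (v (j + 1) - v j + |distIncr v j l|) / 2 := by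
  rw [stepCov, abs_div, abs_two]
  gcongr
  exact (abs_sub _ _).trans_eq (by rw [abs_of_nonneg (hv.sub_nonneg j)])

theorem sum_abs_stepCov_le (hv : IsConcaveVariogram v) {l N : ℕ} (h : l ≤ N) :
    ∑ j ∈ range N, |stepCov v j l| ≤ 3 / 2 * v N := by
  calc ∑ j ∈ range N, |stepCov v j l|
      ≤ ∑ j ∈ range N, (v (j + 1) - v j + |distIncr v j l|) / 2 :=
        sum_le_sum fun j _ => hv.abs_stepCov_le j l
    _ = (v N + ∑ j ∈ range N, |distIncr v j l|) / 2 := by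
        rw [← sum_div, sum_add_distrib, sum_range_sub, hv.zero, sub_zero]
    _ ≤ 3 / 2 * v N := by linarith [hv.sum_abs_distIncr_le h]

theorem abs_midCov_le (hv : IsConcaveVariogram v) (j k : ℕ) : |midCov v j k| ≤ v 1 := by
  have hstep l : |stepCov v j l| ≤ v 1 := by
    linarith [hv.abs_stepCov_le j l, hv.sub_le j, hv.abs_distIncr_le j l]
  rw [midCov, abs_div, abs_two]
  linarith [abs_add_le (stepCov v j k) (stepCov v j (k + 1)), hstep k, hstep (k + 1)]

theorem midCov_self (hv : IsConcaveVariogram v) (j : ℕ) : midCov v j j = (v (j + 1) - v j) / 2 := by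
  have hincr := hv.incrCov_self j
  have hself := distIncr_add_left v j 0
  rw [add_zero, zero_add, hv.zero, sub_zero] at hself
  have hstep : stepCov v j j = (v (j + 1) - v j - v 1) / 2 := by rw [stepCov, hself]
  rw [incrCov] at hincr
  rw [midCov]
  linarith

theorem sum_abs_midCov_self (hv : IsConcaveVariogram v) (N : ℕ) :
    ∑ j ∈ range N, |midCov v j j| = v N / 2 := by
  simp only [hv.midCov_self, abs_of_nonneg (div_nonneg (hv.sub_nonneg _) zero_le_two)]
  rw [← sum_div, sum_range_sub, hv.zero, sub_zero]

theorem sum_abs_midCov_le (hv : IsConcaveVariogram v) {k N : ℕ} (hk : k < N) :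
    ∑ j ∈ range N, |midCov v j k| ≤ 3 / 2 * v N := by
  calc ∑ j ∈ range N, |midCov v j k|
      ≤ ∑ j ∈ range N, (|stepCov v j k| + |stepCov v j (k + 1)|) / 2 :=
        sum_le_sum fun j _ => by
          rw [midCov, abs_div, abs_two]
          gcongr
          exact abs_add_le _ _
    _ = (∑ j ∈ range N, |stepCov v j k| + ∑ j ∈ range N, |stepCov v j (k + 1)|) / 2 := by
        rw [← sum_div, sum_add_distrib]
    _ ≤ 3 / 2 * v N := by
        linarith [hv.sum_abs_stepCov_le hk.le, hv.sum_abs_stepCov_le (Nat.succ_le_of_lt hk)]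

theorem sum_sum_abs_incrCov_le (hv : IsConcaveVariogram v) (N : ℕ) :
    ∑ j ∈ range N, ∑ k ∈ range N, |incrCov v j k| ≤ N * (2 * v 1) := by
  simpa using sum_le_card_nsmul (range N) _ _ fun j hj => hv.sum_abs_incrCov_le (mem_range.1 hj)

theorem sum_sum_abs_midCov_le (hv : IsConcaveVariogram v) (N : ℕ) :
    ∑ j ∈ range N, ∑ k ∈ range N, (|midCov v j k| + |midCov v j j|) ≤ N * (2 * v N) := by
  have hoff : ∑ j ∈ range N, ∑ k ∈ range N, |midCov v j k| ≤ N * (3 / 2 * v N) := by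
    rw [sum_comm]
    simpa using sum_le_card_nsmul (range N) _ _ fun k hk => hv.sum_abs_midCov_le (mem_range.1 hk)
  have hdiag : ∑ j ∈ range N, ∑ _k ∈ range N, |midCov v j j| = N * (v N / 2) := by
    simp only [sum_const, card_range, nsmul_eq_mul, ← mul_sum, hv.sum_abs_midCov_self]
  simp only [sum_add_distrib]
  linarith

end IsConcaveVariogram

end ConcaveVariogram

section StationaryIncrements

open Finset

variable {Ω : Type*}

/-- `x` is a centered Gaussian sequence started at `0` whose increments are stationary, with
variance `v (dist j k)` between the times `j` and `k`. -/
structure IsGaussianWithVariogram [MeasurableSpace Ω] (P : Measure Ω) (v : ℕ → ℝ)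
    (x : ℕ → Ω → ℝ) : Prop where
  isGaussianProcess : IsGaussianProcess x P
  integral_eq_zero : ∀ j, ∫ ω, x j ω ∂P = 0
  covariance_eq : ∀ j k, cov[x j, x k; P] = (v j + v k - v (Nat.dist j k)) / 2

/-- The `j`-th and `k`-th increments of `x`, divided by `s`, followed by the midpoints of the
corresponding steps. -/
noncomputable def stepVector (s : ℝ) (x : ℕ → Ω → ℝ) (j k : ℕ) : Fin 4 → Ω → ℝ :=
  ![fun ω => s⁻¹ * (x (j + 1) ω - x j ω), fun ω => s⁻¹ * (x (k + 1) ω - x k ω),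
    fun ω => 1 / 2 * (x j ω + x (j + 1) ω), fun ω => 1 / 2 * (x k ω + x (k + 1) ω)]

/-- The functions whose product, evaluated along `stepVector`, is up to scaling the product of the
`j`-th and `k`-th terms of `midpointSum f p`. -/
def stepFactor (f : ℝ → ℝ) (p : ℕ) : Fin 4 → ℝ → ℝ := ![fun y => y ^ p, fun y => y ^ p, f, f]

theorem SmoothSubGaussian.stepFactor {f : ℝ → ℝ} (hf : SmoothSubGaussian f) (p : ℕ) :
    ∀ i, SmoothSubGaussian (stepFactor f p i) :=
  Fin.forall_fin_succ.2 ⟨.pow p, Fin.forall_fin_succ.2 ⟨.pow p, Fin.forall_fin_two.2 ⟨hf, hf⟩⟩⟩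

theorem midpointSum_sq_eq {s : ℝ} (hs : s ≠ 0) (f : ℝ → ℝ) (p : ℕ) (x : ℕ → Ω → ℝ) (N : ℕ) (ω : Ω) :
    midpointSum f p (x · ω) N ^ 2 = s ^ (2 * p) * ∑ j ∈ range N, ∑ k ∈ range N,
      ∏ i, stepFactor f p i (stepVector s x j k i ω) := by
  have hstep j : x (j + 1) ω - x j ω = s * (s⁻¹ * (x (j + 1) ω - x j ω)) :=
    (mul_inv_cancel_left₀ hs _).symm
  rw [midpointSum, sq, sum_mul_sum, mul_sum]
  refine sum_congr rfl fun j _ => ?_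
  rw [mul_sum]
  refine sum_congr rfl fun k _ => ?_
  rw [hstep j, hstep k, Fin.prod_univ_four]
  change _ = s ^ (2 * p) * ((s⁻¹ * (x (j + 1) ω - x j ω)) ^ p * (s⁻¹ * (x (k + 1) ω - x k ω)) ^ p *
    f (1 / 2 * (x j ω + x (j + 1) ω)) * f (1 / 2 * (x k ω + x (k + 1) ω)))
  rw [mul_pow s, mul_pow s]
  ring

variable [MeasurableSpace Ω] {P : Measure Ω}

namespace IsGaussianWithVariogram

variable {v : ℕ → ℝ} {x : ℕ → Ω → ℝ}

theorem memLp_two (hx : IsGaussianWithVariogram P v x) (j : ℕ) : MemLp (x j) 2 P :=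
  (hx.isGaussianProcess.hasGaussianLaw_eval j).memLp_two

theorem memLp_two_incr (hx : IsGaussianWithVariogram P v x) (j : ℕ) :
    MemLp (fun ω => x (j + 1) ω - x j ω) 2 P :=
  (hx.memLp_two (j + 1)).sub (hx.memLp_two j)

theorem covariance_incr (hx : IsGaussianWithVariogram P v x) (j l : ℕ) :
    cov[fun ω => x (j + 1) ω - x j ω, x l; P] = stepCov v j l := by
  have := hx.isGaussianProcess.isProbabilityMeasure
  rw [covariance_fun_sub_left (hx.memLp_two _) (hx.memLp_two _) (hx.memLp_two _),
    hx.covariance_eq, hx.covariance_eq, stepCov, distIncr]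
  ring

theorem covariance_incr_incr (hx : IsGaussianWithVariogram P v x) (j k : ℕ) :
    cov[fun ω => x (j + 1) ω - x j ω, fun ω => x (k + 1) ω - x k ω; P] = incrCov v j k := by
  have := hx.isGaussianProcess.isProbabilityMeasure
  rw [covariance_fun_sub_right (hx.memLp_two_incr j) (hx.memLp_two _) (hx.memLp_two _),
    hx.covariance_incr, hx.covariance_incr, incrCov]

theorem covariance_incr_mid (hx : IsGaussianWithVariogram P v x) (j k : ℕ) :
    cov[fun ω => x (j + 1) ω - x j ω, fun ω => 1 / 2 * (x k ω + x (k + 1) ω); P] =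
      midCov v j k := by
  have := hx.isGaussianProcess.isProbabilityMeasure
  change cov[_, fun ω => 1 / 2 * (x k + x (k + 1)) ω; P] = _
  rw [covariance_const_mul_right, covariance_add_right (hx.memLp_two_incr j) (hx.memLp_two _)
    (hx.memLp_two _), hx.covariance_incr, hx.covariance_incr, midCov]
  ring

theorem variance_mid_le (hx : IsGaussianWithVariogram P v x) (hv : IsConcaveVariogram v) (j : ℕ) :
    Var[fun ω => 1 / 2 * (x j ω + x (j + 1) ω); P] ≤ v (j + 1) := by
  have := hx.isGaussianProcess.isProbabilityMeasure
  have hdist : Nat.dist j (j + 1) = 1 := by simp [Nat.dist]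
  rw [variance_const_mul, variance_fun_add (hx.memLp_two _) (hx.memLp_two _),
    ← covariance_self (hx.memLp_two _).aemeasurable,
    ← covariance_self (hx.memLp_two _).aemeasurable, hx.covariance_eq, hx.covariance_eq,
    hx.covariance_eq, Nat.dist_self, Nat.dist_self, hdist, hv.zero]
  linarith [hv.nonneg 1, hv.monotone j.le_succ]

theorem hasGaussianLaw_stepVector (hx : IsGaussianWithVariogram P v x) (s : ℝ) (j k : ℕ) :
    HasGaussianLaw (fun ω i => stepVector s x j k i ω) P := by
  classical
  let T : Fin 4 → ℕ := ![j, j + 1, k, k + 1]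
  let eval (i : Fin 4) : ({i : Fin 4 // i ∈ univ} → ℝ) →L[ℝ] ℝ :=
    ContinuousLinearMap.proj ⟨i, mem_univ i⟩
  let L : ({i : Fin 4 // i ∈ univ} → ℝ) →L[ℝ] (Fin 4 → ℝ) := ContinuousLinearMap.pi
    ![s⁻¹ • (eval 1 - eval 0), s⁻¹ • (eval 3 - eval 2), (1 / 2 : ℝ) • (eval 0 + eval 1),
      (1 / 2 : ℝ) • (eval 2 + eval 3)]
  have hL : (fun ω i => stepVector s x j k i ω) =
      L ∘ fun ω (i : {i : Fin 4 // i ∈ univ}) => x (T i) ω := by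
    funext ω i
    fin_cases i <;> rfl
  rw [hL]
  exact ((hx.isGaussianProcess.comp_right T).hasGaussianLaw univ).map L

theorem isCenteredGaussian_stepVector (hx : IsGaussianWithVariogram P v x)
    (hv : IsConcaveVariogram v) (h1 : 0 < v 1) {V : ℝ} (hV : 1 ≤ V) {N j k : ℕ} (hN : v N ≤ V)
    (hj : j < N) (hk : k < N) : IsCenteredGaussian P V (stepVector √(v 1) x j k) := by
  have hint j := (hx.isGaussianProcess.hasGaussianLaw_eval j).integrable
  have hincr j : ∫ ω, (√(v 1))⁻¹ * (x (j + 1) ω - x j ω) ∂P = 0 := by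
    rw [integral_const_mul, integral_sub (hint _) (hint _), hx.integral_eq_zero,
      hx.integral_eq_zero, sub_zero, mul_zero]
  have hmid j : ∫ ω, 1 / 2 * (x j ω + x (j + 1) ω) ∂P = 0 := by
    rw [integral_const_mul, integral_add (hint _) (hint _), hx.integral_eq_zero,
      hx.integral_eq_zero, add_zero, mul_zero]
  have hvar_incr j : Var[fun ω => (√(v 1))⁻¹ * (x (j + 1) ω - x j ω); P] ≤ V := by
    rw [variance_const_mul, ← covariance_self (hx.memLp_two_incr j).aemeasurable,
      hx.covariance_incr_incr, hv.incrCov_self, inv_pow, Real.sq_sqrt h1.le,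
      inv_mul_cancel₀ h1.ne']
    exact hV
  have hvar_mid {j} (hj : j < N) : Var[fun ω => 1 / 2 * (x j ω + x (j + 1) ω); P] ≤ V :=
    (hx.variance_mid_le hv j).trans ((hv.monotone (Nat.succ_le_of_lt hj)).trans hN)
  exact ⟨hx.hasGaussianLaw_stepVector _ j k,
    Fin.forall_fin_succ.2 ⟨hincr j, Fin.forall_fin_succ.2 ⟨hincr k, Fin.forall_fin_two.2
      ⟨hmid j, hmid k⟩⟩⟩,
    Fin.forall_fin_succ.2 ⟨hvar_incr j, Fin.forall_fin_succ.2 ⟨hvar_incr k, Fin.forall_fin_two.2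
      ⟨hvar_mid hj, hvar_mid hk⟩⟩⟩⟩

theorem sum_abs_covariance_stepVector (hx : IsGaussianWithVariogram P v x) (h1 : 0 < v 1)
    (j k : ℕ) :
    |cov[stepVector √(v 1) x j k 0, stepVector √(v 1) x j k 1; P]| +
      ∑ l ∈ (univ.erase 0).erase 1, |cov[stepVector √(v 1) x j k 0, stepVector √(v 1) x j k l; P]| *
        ∑ m ∈ univ.erase 1, |cov[stepVector √(v 1) x j k 1, stepVector √(v 1) x j k m; P]| =
    |incrCov v j k| / v 1 + (|midCov v j j| + |midCov v j k|) / √(v 1) *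
      (|incrCov v j k| / v 1 + (|midCov v k j| + |midCov v k k|) / √(v 1)) := by
  have hincr j k : |cov[fun ω => (√(v 1))⁻¹ * (x (j + 1) ω - x j ω),
      fun ω => (√(v 1))⁻¹ * (x (k + 1) ω - x k ω); P]| = |incrCov v j k| / v 1 := by
    rw [covariance_const_mul_left, covariance_const_mul_right, hx.covariance_incr_incr,
      ← mul_assoc, ← mul_inv, Real.mul_self_sqrt h1.le, abs_mul, abs_inv, abs_of_pos h1,
      inv_mul_eq_div]
  have hmid j k : |cov[fun ω => (√(v 1))⁻¹ * (x (j + 1) ω - x j ω),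
      fun ω => 1 / 2 * (x k ω + x (k + 1) ω); P]| = |midCov v j k| / √(v 1) := by
    rw [covariance_const_mul_left, hx.covariance_incr_mid, abs_mul, abs_inv,
      abs_of_nonneg (Real.sqrt_nonneg _), inv_mul_eq_div]
  have hsum₁ (u : Fin 4 → ℝ) : ∑ l ∈ (univ.erase 0).erase 1, u l = u 2 + u 3 := by
    rw [show (univ.erase (0 : Fin 4)).erase 1 = {2, 3} from rfl, sum_pair (by decide)]
  have hsum₂ (u : Fin 4 → ℝ) : ∑ m ∈ univ.erase 1, u m = u 0 + (u 2 + u 3) := by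
    rw [show univ.erase (1 : Fin 4) = {0, 2, 3} from rfl, sum_insert (by decide),
      sum_pair (by decide)]
  rw [← sum_mul, hsum₁, hsum₂, covariance_comm (stepVector _ x j k 1) (stepVector _ x j k 0)]
  refine Eq.trans (b := _) (congrArg₂ _ (hincr j k) (congrArg₂ _ (congrArg₂ _ (hmid j j) (hmid j k))
    (congrArg₂ _ (hincr j k) (congrArg₂ _ (hmid k j) (hmid k k))))) ?_
  ring

end IsGaussianWithVariogram

theorem exists_mixedMoment_stepVector_le {V : ℝ} (hV : 1 ≤ V) {f : ℝ → ℝ} (hf : SmoothSubGaussian f)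
    {p : ℕ} (hp : Odd p) : ∃ C, 0 ≤ C ∧ ∀ v (x : ℕ → Ω → ℝ) N, IsConcaveVariogram v → 0 < v 1 →
      v N ≤ V → IsGaussianWithVariogram P v x → ∀ j < N, ∀ k < N,
        mixedMoment P (stepFactor f p) (stepVector √(v 1) x j k) ≤
          C * ((1 + 2 * V) * (|incrCov v j k| / v 1) + 2 * (|midCov v k j| + |midCov v k k|)) := by
  obtain ⟨C, hC0, hC⟩ := (mixedMoment_isBigO_of_odd_pow_of_odd_pow (P := P) (one_pos.trans_le hV)
    (hf.stepFactor p) (i := 0) (j := 1) (by decide) hp rfl hp rfl).exists_nonneg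
  rw [Asymptotics.isBigOWith_principal] at hC
  refine ⟨C, hC0, fun v x N hv h1 hN hx j hj k hk => (le_abs_self _).trans <|
    (hC _ (hx.isCenteredGaussian_stepVector hv h1 hV hN hj hk)).trans ?_⟩
  have hs : 0 < √(v 1) := Real.sqrt_pos.2 h1
  have hs_le : √(v 1) ≤ V := Real.sqrt_le_iff.2 ⟨by positivity,
    ((hv.monotone (Nat.one_le_of_lt hj)).trans hN).trans (le_self_pow₀ hV two_ne_zero)⟩
  have hmid l : |midCov v j l| ≤ √(v 1) ^ 2 := (hv.abs_midCov_le j l).trans_eq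
    (Real.sq_sqrt h1.le).symm
  have hmid_div : (|midCov v j j| + |midCov v j k|) / √(v 1) ≤ 2 * √(v 1) := by
    rw [div_le_iff₀ hs]
    linarith [hmid j, hmid k]
  rw [hx.sum_abs_covariance_stepVector h1, Real.norm_of_nonneg (by positivity)]
  refine mul_le_mul_of_nonneg_left ?_ hC0
  calc |incrCov v j k| / v 1 + (|midCov v j j| + |midCov v j k|) / √(v 1) *
        (|incrCov v j k| / v 1 + (|midCov v k j| + |midCov v k k|) / √(v 1))
      ≤ |incrCov v j k| / v 1 + 2 * √(v 1) *
        (|incrCov v j k| / v 1 + (|midCov v k j| + |midCov v k k|) / √(v 1)) := by gcongr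
    _ = (1 + 2 * √(v 1)) * (|incrCov v j k| / v 1) + 2 * (|midCov v k j| + |midCov v k k|) := by
        field_simp
        ring
    _ ≤ _ := by gcongr

theorem exists_integral_midpointSum_sq_le (P : Measure Ω) {V : ℝ} (hV : 1 ≤ V) {f : ℝ → ℝ}
    (hf : SmoothSubGaussian f) {p : ℕ} (hp : Odd p) : ∃ C, ∀ v (x : ℕ → Ω → ℝ) N,
      IsConcaveVariogram v → 0 < v 1 → v N ≤ V → IsGaussianWithVariogram P v x →
        Integrable (fun ω => midpointSum f p (x · ω) N ^ 2) P ∧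
        ∫ ω, midpointSum f p (x · ω) N ^ 2 ∂P ≤ C * (N * v 1 ^ p) := by
  obtain ⟨C, hC0, hC⟩ := exists_mixedMoment_stepVector_le (P := P) hV hf hp
  refine ⟨C * (2 + 8 * V), fun v x N hv h1 hN hx => ?_⟩
  have hint j (hj : j ∈ range N) k (hk : k ∈ range N) := (hx.isCenteredGaussian_stepVector hv h1 hV
    hN (mem_range.1 hj) (mem_range.1 hk)).integrable_prod (one_pos.trans_le hV)
    fun i => (hf.stepFactor p i).growth
  have hint_sum j (hj : j ∈ range N) := integrable_finsetSum _ (hint j hj)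
  have hpow : √(v 1) ^ (2 * p) = v 1 ^ p := by rw [pow_mul, Real.sq_sqrt h1.le]
  simp only [midpointSum_sq_eq (Real.sqrt_pos.2 h1).ne', hpow]
  refine ⟨(integrable_finsetSum _ hint_sum).const_mul _, ?_⟩
  rw [integral_const_mul, integral_finsetSum _ hint_sum]
  have hincr : ∑ j ∈ range N, ∑ k ∈ range N, |incrCov v j k| / v 1 ≤ N * 2 := by
    simp only [← sum_div]
    rw [div_le_iff₀ h1, mul_assoc]
    exact hv.sum_sum_abs_incrCov_le N
  have hmid : ∑ j ∈ range N, ∑ k ∈ range N, (|midCov v k j| + |midCov v k k|) ≤ N * (2 * V) := by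
    rw [sum_comm]
    exact (hv.sum_sum_abs_midCov_le N).trans (by gcongr)
  calc v 1 ^ p * ∑ j ∈ range N, ∫ ω, ∑ k ∈ range N,
        ∏ i, stepFactor f p i
          (stepVector √(v 1) x j k i ω) ∂P
      ≤ v 1 ^ p * ∑ j ∈ range N, ∑ k ∈ range N, C * ((1 + 2 * V) * (|incrCov v j k| / v 1) +
          2 * (|midCov v k j| + |midCov v k k|)) := by
        gcongr with j hj
        rw [integral_finsetSum _ (hint j hj)]
        exact sum_le_sum fun k hk => hC v x N hv h1 hN hx j (mem_range.1 hj) k (mem_range.1 hk)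
    _ = v 1 ^ p * (C * ((1 + 2 * V) * ∑ j ∈ range N, ∑ k ∈ range N, |incrCov v j k| / v 1 +
          2 * ∑ j ∈ range N, ∑ k ∈ range N, (|midCov v k j| + |midCov v k k|))) := by
        simp only [← mul_sum, sum_add_distrib]
    _ ≤ v 1 ^ p * (C * ((1 + 2 * V) * (N * 2) + 2 * (N * (2 * V)))) := by gcongr
    _ = C * (2 + 8 * V) * (N * v 1 ^ p) := by ring

end StationaryIncrements

section WeightedIncrement

variable {Ω : Type*} [MeasurableSpace Ω] {P : Measure Ω}

theorem exists_weightedIncrement_le_exp {ε : ℝ} (hε : 0 < ε) (p : ℕ) :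
    ∃ C, 0 ≤ C ∧ ∀ σ, 0 < σ → ∀ a b, weightedIncrement ε p a b ≤ C * σ ^ p *
      (Real.exp (2 * ε * a ^ 2) + Real.exp (2 * ε * b ^ 2) +
        Real.exp (2 * ε * (σ⁻¹ * (b - a)) ^ 2)) := by
  obtain ⟨C, hC0, hC⟩ := (SubGaussianGrowth.pow p).exists_nonneg_bound hε
  refine ⟨C, hC0, fun σ hσ a b => ?_⟩
  set z := σ⁻¹ * (b - a)
  have hz : |b - a| ^ p = σ ^ p * |z ^ p| := by
    rw [abs_pow, ← mul_pow, abs_mul, abs_inv, abs_of_pos hσ, mul_inv_cancel_left₀ hσ.ne']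
  have hexp y : Real.exp (2 * ε * y ^ 2) = Real.exp (ε * y ^ 2) ^ 2 := by
    rw [← Real.exp_nat_mul]
    push_cast
    ring_nf
  have hyoung : (Real.exp (ε * a ^ 2) + Real.exp (ε * b ^ 2)) * Real.exp (ε * z ^ 2) ≤
      Real.exp (2 * ε * a ^ 2) + Real.exp (2 * ε * b ^ 2) + Real.exp (2 * ε * z ^ 2) := by
    simp only [hexp]
    linarith [two_mul_le_add_sq (Real.exp (ε * a ^ 2)) (Real.exp (ε * z ^ 2)),
      two_mul_le_add_sq (Real.exp (ε * b ^ 2)) (Real.exp (ε * z ^ 2)),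
      sq_nonneg (Real.exp (ε * a ^ 2)), sq_nonneg (Real.exp (ε * b ^ 2))]
  calc weightedIncrement ε p a b
      ≤ (Real.exp (ε * a ^ 2) + Real.exp (ε * b ^ 2)) *
          (σ ^ p * (C * Real.exp (ε * z ^ 2))) := by
        rw [weightedIncrement, hz]
        gcongr
        exact hC z
    _ = C * σ ^ p * ((Real.exp (ε * a ^ 2) + Real.exp (ε * b ^ 2)) * Real.exp (ε * z ^ 2)) := by
        ring
    _ ≤ _ := by gcongr

theorem eLpNorm_one_le_ofReal_integral {F G : Ω → ℝ} (hG : Integrable G P)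
    (h : ∀ ω, |F ω| ≤ G ω) : eLpNorm F 1 P ≤ ENNReal.ofReal (∫ ω, G ω ∂P) := by
  have hnorm : ∫ ω, G ω ∂P = ∫ ω, ‖G ω‖ ∂P := integral_congr_ae <| ae_of_all _ fun ω =>
    (Real.norm_of_nonneg ((abs_nonneg _).trans (h ω))).symm
  rw [hnorm, ofReal_integral_norm_eq_lintegral_enorm hG, ← eLpNorm_one_eq_lintegral_enorm]
  exact eLpNorm_mono_real h

theorem exists_eLpNorm_weightedIncrement_le_of_hasGaussianLaw (P : Measure Ω) {ε : ℝ}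
    (hε : 0 < ε) (p : ℕ) :
    ∃ C, ∀ (X Y : Ω → ℝ) (σ : ℝ), 0 < σ → HasGaussianLaw X P → HasGaussianLaw Y P →
      HasGaussianLaw (fun ω => Y ω - X ω) P → ∫ ω, X ω ∂P = 0 → ∫ ω, Y ω ∂P = 0 →
      8 * ε * Var[X; P] ≤ 1 → 8 * ε * Var[Y; P] ≤ 1 →
      8 * ε * Var[fun ω => Y ω - X ω; P] ≤ σ ^ 2 →
      eLpNorm (fun ω => weightedIncrement ε p (X ω) (Y ω)) 1 P ≤ ENNReal.ofReal (C * σ ^ p) := by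
  obtain ⟨C, hC0, hC⟩ := exists_weightedIncrement_le_exp hε p
  refine ⟨C * (3 * √2), fun X Y σ hσ hX hY hXY hX0 hY0 hXv hYv hXYv => ?_⟩
  have hZ : HasGaussianLaw (fun ω => σ⁻¹ * (Y ω - X ω)) P := hXY.fun_smul σ⁻¹
  have hZ0 : ∫ ω, σ⁻¹ * (Y ω - X ω) ∂P = 0 := by
    rw [integral_const_mul, integral_sub hY.integrable hX.integrable, hX0, hY0, sub_zero, mul_zero]
  have hZv : 2 * ε * Var[fun ω => σ⁻¹ * (Y ω - X ω); P] ≤ 1 / 4 := by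
    have hscale := inv_mul_le_one_of_le₀ hXYv (sq_nonneg σ)
    rw [variance_const_mul, inv_pow]
    linarith
  replace hXv : 2 * ε * Var[X; P] ≤ 1 / 4 := by linarith
  replace hYv : 2 * ε * Var[Y; P] ≤ 1 / 4 := by linarith
  have iXY := (integrable_exp_mul_sq hX hX0 hXv).fun_add (integrable_exp_mul_sq hY hY0 hYv)
  have iZ := integrable_exp_mul_sq hZ hZ0 hZv
  refine (eLpNorm_one_le_ofReal_integral ((iXY.fun_add iZ).const_mul (C * σ ^ p)) fun ω => ?_).trans
    (ENNReal.ofReal_le_ofReal ?_)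
  · exact (abs_of_nonneg (weightedIncrement_nonneg _ _ _ _)).trans_le (hC σ hσ _ _)
  · rw [integral_const_mul, integral_add iXY iZ,
      integral_add (integrable_exp_mul_sq hX hX0 hXv) (integrable_exp_mul_sq hY hY0 hYv),
      mul_right_comm]
    gcongr
    linarith [integral_exp_mul_sq_le hX hX0 hXv, integral_exp_mul_sq_le hY hY0 hYv,
      integral_exp_mul_sq_le hZ hZ0 hZv]

theorem eLpNorm_one_le_ofReal_sqrt [IsProbabilityMeasure P] {S : Ω → ℝ}
    (hS : AEStronglyMeasurable S P) (hint : Integrable (fun ω => S ω ^ 2) P) :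
    eLpNorm S 1 P ≤ ENNReal.ofReal √(∫ ω, S ω ^ 2 ∂P) := by
  refine (eLpNorm_le_eLpNorm_of_exponent_le one_le_two hS).trans_eq ?_
  rw [((memLp_two_iff_integrable_sq hS).2 hint).eLpNorm_eq_integral_rpow_norm two_ne_zero
    ENNReal.ofNat_ne_top, Real.sqrt_eq_rpow]
  simp

end WeightedIncrement

section FractionalBrownianMotion

theorem isConcaveVariogram_div_rpow {r : ℝ} (h₀ : 0 < r) (h₁ : r ≤ 1) (n : ℕ) :
    IsConcaveVariogram fun k => ((k : ℝ) / n) ^ r where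
  zero := by simp only [Nat.cast_zero, zero_div, Real.zero_rpow h₀.ne']
  monotone j k h := by
    dsimp only
    gcongr
  antitone_sub := antitone_nat_of_succ_le fun k => by
    have hk j : (0 : ℝ) ≤ (j : ℕ) / (n : ℝ) := by positivity
    have hhalf : (0 : ℝ) ≤ 1 / 2 := by norm_num
    have hmid := (Real.concaveOn_rpow h₀.le h₁).2 (hk k) (hk (k + 1 + 1)) hhalf hhalf (add_halves 1)
    have hcenter : (1 / 2 : ℝ) • (k / n : ℝ) + (1 / 2 : ℝ) • ((k + 1 + 1 : ℕ) / (n : ℝ)) =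
        (k + 1 : ℕ) / (n : ℝ) := by
      push_cast [smul_eq_mul]
      ring
    rw [hcenter, smul_eq_mul, smul_eq_mul] at hmid
    linarith

theorem cast_natDist (j k : ℕ) : (Nat.dist j k : ℝ) = |(k : ℝ) - j| := by
  rcases le_total j k with h | h
  · rw [Nat.dist_eq_sub_of_le h, Nat.cast_sub h, abs_of_nonneg (sub_nonneg.2 (mod_cast h))]
  · rw [Nat.dist_eq_sub_of_le_right h, Nat.cast_sub h, abs_sub_comm,
      abs_of_nonneg (sub_nonneg.2 (mod_cast h))]

namespace IsFractionalBrownianMotion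

variable {Ω : Type*} [MeasurableSpace Ω] {P : Measure Ω} {H : ℝ} {B : ℝ≥0 → Ω → ℝ}

theorem memLp_two (hB : IsFractionalBrownianMotion H B P) (s : ℝ≥0) : MemLp (B s) 2 P :=
  (hB.isGaussianProcess.hasGaussianLaw_eval s).memLp_two

theorem covariance_eq (hB : IsFractionalBrownianMotion H B P) (s t : ℝ≥0) :
    cov[B s, B t; P] =
      1 / 2 * ((s : ℝ) ^ (2 * H) + (t : ℝ) ^ (2 * H) - |(t : ℝ) - s| ^ (2 * H)) := by
  have := hB.isGaussianProcess.isProbabilityMeasure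
  rw [covariance_eq_sub (hB.memLp_two s) (hB.memLp_two t), hB.centered s, zero_mul, sub_zero]
  exact hB.covariance s t

theorem variance_eq (hB : IsFractionalBrownianMotion H B P) (hH : 0 < H) (s : ℝ≥0) :
    Var[B s; P] = (s : ℝ) ^ (2 * H) := by
  rw [← covariance_self (hB.isGaussianProcess.aemeasurable s), hB.covariance_eq, sub_self,
    abs_zero, Real.zero_rpow (by positivity)]
  ring

theorem variance_sub (hB : IsFractionalBrownianMotion H B P) (hH : 0 < H) (s t : ℝ≥0) :
    Var[fun ω => B t ω - B s ω; P] = |(t : ℝ) - s| ^ (2 * H) := by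
  have := hB.isGaussianProcess.isProbabilityMeasure
  rw [ProbabilityTheory.variance_fun_sub (hB.memLp_two t) (hB.memLp_two s), hB.variance_eq hH,
    hB.variance_eq hH, hB.covariance_eq, abs_sub_comm (s : ℝ)]
  ring

theorem ae_zero (hB : IsFractionalBrownianMotion H B P) (hH : 0 < H) : ∀ᵐ ω ∂P, B 0 ω = 0 := by
  have := hB.isGaussianProcess.isProbabilityMeasure
  have hvar : Var[B 0; P] = 0 := by
    rw [hB.variance_eq hH, NNReal.coe_zero, Real.zero_rpow (by positivity)]
  simpa only [hB.centered] using ae_eq_integral_of_variance_eq_zero (hB.memLp_two 0) hvar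

theorem isGaussianWithVariogram_grid (hB : IsFractionalBrownianMotion H B P) (n : ℕ) :
    IsGaussianWithVariogram P (fun k => ((k : ℝ) / n) ^ (2 * H)) fun j => B (j / n) where
  isGaussianProcess := hB.isGaussianProcess.comp_right fun j : ℕ => (j / n : ℝ≥0)
  integral_eq_zero j := hB.centered _
  covariance_eq j k := by
    rw [hB.covariance_eq, cast_natDist]
    push_cast
    rw [← sub_div, abs_div, Nat.abs_cast]
    ring

theorem exists_eLpNorm_weightedIncrement_le (hB : IsFractionalBrownianMotion H B P) (hH : 0 < H)
    {V : ℝ} (hV : 1 ≤ V) (p : ℕ) : ∃ C, ∀ (s u : ℝ≥0) (δ : ℝ), 0 < δ → (s : ℝ) ^ (2 * H) ≤ V →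
      (u : ℝ) ^ (2 * H) ≤ V → |(u : ℝ) - s| ≤ δ →
      eLpNorm (fun ω => weightedIncrement (1 / (8 * V)) p (B s ω) (B u ω)) 1 P ≤
        ENNReal.ofReal (C * (δ ^ H) ^ p) := by
  obtain ⟨C, hC⟩ := exists_eLpNorm_weightedIncrement_le_of_hasGaussianLaw P
    (ε := 1 / (8 * V)) (by positivity) p
  refine ⟨C, fun s u δ hδ hs hu hsu => ?_⟩
  have hε : 8 * (1 / (8 * V)) = V⁻¹ := by
    field_simp
  have hscale : |(u : ℝ) - s| ^ (2 * H) ≤ (δ ^ H) ^ 2 := by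
    rw [← Real.rpow_mul_natCast hδ.le, mul_comm H]
    exact Real.rpow_le_rpow (abs_nonneg _) hsu (by positivity)
  have hG r := hB.isGaussianProcess.hasGaussianLaw_eval r
  have hvar {r : ℝ≥0} (hr : (r : ℝ) ^ (2 * H) ≤ V) : 8 * (1 / (8 * V)) * Var[B r; P] ≤ 1 := by
    rw [hε, hB.variance_eq hH]
    exact inv_mul_le_one_of_le₀ hr (by positivity)
  refine hC _ _ _ (Real.rpow_pos_of_pos hδ H) (hG s) (hG u)
    hB.isGaussianProcess.hasGaussianLaw_fun_sub (hB.centered s) (hB.centered u) (hvar hs) (hvar hu)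
    ?_
  rw [hε, hB.variance_sub hH]
  exact (mul_le_of_le_one_left (by positivity) (inv_le_one_of_one_le₀ hV)).trans hscale

end IsFractionalBrownianMotion

end FractionalBrownianMotion

section Convergence

open Finset

variable {Ω : Type*} [MeasurableSpace Ω] {P : Measure Ω}

/-- Convergence to `0` in `L¹(P)` of a sequence of real random variables. -/
structure TendstoZeroInL1 (P : Measure Ω) (F : ℕ → Ω → ℝ) : Prop where
  aestronglyMeasurable : ∀ n, AEStronglyMeasurable (F n) P
  tendsto_eLpNorm : Tendsto (fun n => eLpNorm (F n) 1 P) atTop (nhds 0)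

namespace TendstoZeroInL1

variable {F G : ℕ → Ω → ℝ}

theorem of_eLpNorm_le (hF : ∀ n, AEStronglyMeasurable (F n) P) {r : ℕ → ENNReal}
    (hr : Tendsto r atTop (nhds 0)) (h : ∀ᶠ n in atTop, eLpNorm (F n) 1 P ≤ r n) :
    TendstoZeroInL1 P F :=
  ⟨hF, tendsto_of_tendsto_of_tendsto_of_le_of_le' tendsto_const_nhds hr (by simp) h⟩

theorem of_abs_le (hF : ∀ n, AEStronglyMeasurable (F n) P) (hG : TendstoZeroInL1 P G)
    (h : ∀ n ω, |F n ω| ≤ G n ω) : TendstoZeroInL1 P F :=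
  of_eLpNorm_le hF hG.tendsto_eLpNorm <| Eventually.of_forall fun n => eLpNorm_mono_real (h n)

theorem abs (hF : TendstoZeroInL1 P F) : TendstoZeroInL1 P fun n ω => |F n ω| :=
  ⟨fun n => (hF.aestronglyMeasurable n).norm, by
    simpa only [← Real.norm_eq_abs, eLpNorm_norm] using hF.tendsto_eLpNorm⟩

theorem const_mul (hF : TendstoZeroInL1 P F) (c : ℝ) : TendstoZeroInL1 P fun n ω => c * F n ω := by
  refine of_eLpNorm_le (fun n => (hF.aestronglyMeasurable n).const_mul c)
    (r := fun n => ‖c‖ₑ * eLpNorm (F n) 1 P) ?_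
    (Eventually.of_forall fun n => (eLpNorm_const_smul c (F n) 1 P).le)
  simpa using ENNReal.Tendsto.const_mul hF.tendsto_eLpNorm (Or.inr enorm_ne_top)

theorem add (hF : TendstoZeroInL1 P F) (hG : TendstoZeroInL1 P G) :
    TendstoZeroInL1 P fun n ω => F n ω + G n ω := by
  refine of_eLpNorm_le
    (fun n => (hF.aestronglyMeasurable n).add (hG.aestronglyMeasurable n)) ?_
    (Eventually.of_forall fun n =>
      eLpNorm_add_le (hF.aestronglyMeasurable n) (hG.aestronglyMeasurable n) le_rfl)
  simpa using hF.tendsto_eLpNorm.add hG.tendsto_eLpNorm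

theorem sum {ι : Type*} {s : Finset ι} {F : ι → ℕ → Ω → ℝ}
    (hF : ∀ i ∈ s, TendstoZeroInL1 P (F i)) : TendstoZeroInL1 P fun n ω => ∑ i ∈ s, F i n ω := by
  refine of_eLpNorm_le
    (fun n => aestronglyMeasurable_fun_sum s fun i hi => (hF i hi).aestronglyMeasurable n)
    (r := fun n => ∑ i ∈ s, eLpNorm (F i n) 1 P) ?_ (Eventually.of_forall fun n => ?_)
  · simpa using tendsto_finsetSum s fun i hi => (hF i hi).tendsto_eLpNorm
  · rw [← Finset.sum_fn]
    exact eLpNorm_sum_le (fun i hi => (hF i hi).aestronglyMeasurable n) le_rfl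

end TendstoZeroInL1

theorem natCast_div_le_of_le_floor {n j : ℕ} {t : ℝ≥0} (h : j ≤ ⌊n * t⌋₊) : (j / n : ℝ≥0) ≤ t := by
  refine NNReal.div_le_of_le_mul ((Nat.cast_le.2 h).trans ?_)
  rw [mul_comm t]
  exact Nat.floor_le (by positivity)

theorem abs_sub_floor_div_le {n : ℕ} (hn : 0 < n) (t : ℝ≥0) :
    |(t : ℝ) - (⌊n * t⌋₊ / n : ℝ≥0)| ≤ (n : ℝ)⁻¹ := by
  have hle : (⌊n * t⌋₊ / n : ℝ≥0) ≤ t := natCast_div_le_of_le_floor le_rfl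
  have hn' : (0 : ℝ) < n := mod_cast hn
  have hlt : (n * t : ℝ) < ⌊n * t⌋₊ + 1 := mod_cast Nat.lt_floor_add_one (n * t)
  rw [abs_of_nonneg (sub_nonneg.2 (NNReal.coe_le_coe.2 hle))]
  push_cast
  field_simp
  linarith

theorem tendsto_floor_mul_inv_rpow_pow (t : ℝ≥0) {r : ℝ} {p : ℕ} (h : 1 < p * r) :
    Tendsto (fun n : ℕ => (⌊n * t⌋₊ : ℝ) * ((n : ℝ)⁻¹ ^ r) ^ p) atTop (nhds 0) := by
  have hdecay := ((tendsto_rpow_neg_atTop (sub_pos.2 h)).comp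
    tendsto_natCast_atTop_atTop).const_mul (t : ℝ)
  rw [mul_zero] at hdecay
  refine squeeze_zero' (Eventually.of_forall fun n => by positivity) ?_ hdecay
  filter_upwards [eventually_gt_atTop 0] with n hn
  have hn' : (0 : ℝ) < n := mod_cast hn
  have hfloor : (⌊n * t⌋₊ : ℝ) ≤ n * t := mod_cast Nat.floor_le (by positivity : 0 ≤ n * t)
  have hpow : (n : ℝ) * ((n : ℝ)⁻¹ ^ r) ^ p = (n : ℝ) ^ (-(p * r - 1)) := by
    rw [Real.inv_rpow hn'.le, ← Real.rpow_neg hn'.le, ← Real.rpow_mul_natCast hn'.le, neg_sub,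
      Real.rpow_sub hn', Real.rpow_one, neg_mul, Real.rpow_neg hn'.le, mul_comm r, div_eq_mul_inv]
  calc (⌊n * t⌋₊ : ℝ) * ((n : ℝ)⁻¹ ^ r) ^ p
      ≤ n * t * ((n : ℝ)⁻¹ ^ r) ^ p := by gcongr
    _ = t * (n : ℝ) ^ (-(p * r - 1)) := by rw [← hpow]; ring

namespace IsFractionalBrownianMotion

variable {H : ℝ} {B : ℝ≥0 → Ω → ℝ}

theorem aestronglyMeasurable_weightedIncrement (hB : IsFractionalBrownianMotion H B P) (ε : ℝ)
    (p : ℕ) (s u : ℝ≥0) :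
    AEStronglyMeasurable (fun ω => weightedIncrement ε p (B s ω) (B u ω)) P := by
  have hm := hB.isGaussianProcess.aemeasurable
  unfold weightedIncrement
  exact AEMeasurable.aestronglyMeasurable (by fun_prop)

theorem aestronglyMeasurable_midpointSum (hB : IsFractionalBrownianMotion H B P) {f : ℝ → ℝ}
    (hf : Measurable f) (p N n : ℕ) :
    AEStronglyMeasurable (fun ω => midpointSum f p (fun j => B (j / n) ω) N) P := by
  have hm := hB.isGaussianProcess.aemeasurable
  unfold midpointSum
  exact AEMeasurable.aestronglyMeasurable (by fun_prop)

theorem aestronglyMeasurable_simpsonSum (hB : IsFractionalBrownianMotion H B P) {g : ℝ → ℝ}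
    (hg : SmoothSubGaussian g) (t : ℝ≥0) (n : ℕ) :
    AEStronglyMeasurable (fun ω => simpsonSum g (B · ω) t n) P := by
  have := hg.deriv.growth.measurable
  have := hB.isGaussianProcess.aemeasurable
  unfold simpsonSum
  exact AEMeasurable.aestronglyMeasurable (by fun_prop)

variable {V : ℝ} {t : ℝ≥0}

theorem tendstoZeroInL1_sum_weightedIncrement (hB : IsFractionalBrownianMotion H B P) (hH : 0 < H)
    (hV : 1 ≤ V) (ht : (t : ℝ) ^ (2 * H) ≤ V) {p : ℕ} (hp : 1 < p * H) :
    TendstoZeroInL1 P fun n ω => ∑ j ∈ range ⌊n * t⌋₊,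
      weightedIncrement (1 / (8 * V)) p (B (j / n) ω) (B ((j + 1 : ℕ) / n) ω) := by
  obtain ⟨C, hC⟩ := hB.exists_eLpNorm_weightedIncrement_le hH hV p
  have hm (n j : ℕ) := hB.aestronglyMeasurable_weightedIncrement (1 / (8 * V)) p
    (j / n) ((j + 1 : ℕ) / n)
  refine .of_eLpNorm_le (fun n => aestronglyMeasurable_fun_sum _ fun j _ => hm n j)
    (r := fun n => ENNReal.ofReal (C * (⌊n * t⌋₊ * ((n : ℝ)⁻¹ ^ H) ^ p))) ?_ ?_
  · simpa using ENNReal.tendsto_ofReal ((tendsto_floor_mul_inv_rpow_pow t hp).const_mul C)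
  filter_upwards [eventually_gt_atTop 0] with n hn
  have htime {j : ℕ} (hj : j ≤ ⌊n * t⌋₊) : ((j / n : ℝ≥0) : ℝ) ^ (2 * H) ≤ V :=
    (Real.rpow_le_rpow (by positivity) (mod_cast natCast_div_le_of_le_floor hj)
      (by positivity)).trans ht
  have hterm j (hj : j ∈ range ⌊n * t⌋₊) : eLpNorm (fun ω => weightedIncrement (1 / (8 * V)) p
      (B (j / n) ω) (B ((j + 1 : ℕ) / n) ω)) 1 P ≤ ENNReal.ofReal (C * ((n : ℝ)⁻¹ ^ H) ^ p) := by
    refine hC _ _ _ (by positivity) (htime (mem_range.1 hj).le) (htime (mem_range.1 hj)) ?_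
    push_cast
    rw [← sub_div, add_sub_cancel_left, one_div, abs_of_nonneg (by positivity)]
  rw [← Finset.sum_fn]
  refine (eLpNorm_sum_le (fun j _ => hm n j) le_rfl).trans
    ((sum_le_card_nsmul _ _ _ hterm).trans_eq ?_)
  rw [card_range, ← ENNReal.ofReal_nsmul, nsmul_eq_mul, mul_left_comm]

theorem tendstoZeroInL1_weightedIncrement_floor (hB : IsFractionalBrownianMotion H B P)
    (hH : 0 < H) (hV : 1 ≤ V) (ht : (t : ℝ) ^ (2 * H) ≤ V) {p : ℕ} (hp : p ≠ 0) :
    TendstoZeroInL1 P fun n ω =>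
      weightedIncrement (1 / (8 * V)) p (B (⌊n * t⌋₊ / n) ω) (B t ω) := by
  obtain ⟨C, hC⟩ := hB.exists_eLpNorm_weightedIncrement_le hH hV p
  refine .of_eLpNorm_le (fun n => hB.aestronglyMeasurable_weightedIncrement _ _ _ _)
    (r := fun n => ENNReal.ofReal (C * ((n : ℝ)⁻¹ ^ H) ^ p)) ?_ ?_
  · have hdecay := (tendsto_inv_atTop_nhds_zero_nat (𝕜 := ℝ)).rpow_const (Or.inr hH.le)
    simpa [Real.zero_rpow hH.ne', hp] using
      ENNReal.tendsto_ofReal ((hdecay.pow p).const_mul C)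
  filter_upwards [eventually_gt_atTop 0] with n hn
  refine hC _ _ _ (by positivity) ?_ ht (abs_sub_floor_div_le hn t)
  exact (Real.rpow_le_rpow (by positivity) (mod_cast natCast_div_le_of_le_floor le_rfl)
    (by positivity)).trans ht

theorem tendstoZeroInL1_midpointSum (hB : IsFractionalBrownianMotion H B P) (hH : 1 / 10 < H)
    {f : ℝ → ℝ} (hf : SmoothSubGaussian f) {p : ℕ} (hodd : Odd p) (hp : 5 ≤ p) (t : ℝ≥0) :
    TendstoZeroInL1 P fun n ω => midpointSum f p (fun j => B (j / n) ω) ⌊n * t⌋₊ := by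
  set V := (t : ℝ) ^ (2 * H) + 1
  have hV : 1 ≤ V := le_add_of_nonneg_left (by positivity)
  have ht : (t : ℝ) ^ (2 * H) ≤ V := le_add_of_nonneg_right zero_le_one
  have hp5 : (5 : ℝ) ≤ p := mod_cast hp
  have hm (n : ℕ) := hB.aestronglyMeasurable_midpointSum hf.growth.measurable p ⌊n * t⌋₊ n
  rcases le_or_gt (2 * H) 1 with hH2 | hH2
  · have := hB.isGaussianProcess.isProbabilityMeasure
    obtain ⟨C, hC⟩ := exists_integral_midpointSum_sq_le P hV hf hodd
    have hdecay : Tendsto (fun n : ℕ => C * (⌊n * t⌋₊ * ((n : ℝ)⁻¹ ^ (2 * H)) ^ p)) atTop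
        (nhds 0) := by
      simpa using (tendsto_floor_mul_inv_rpow_pow t (p := p) (r := 2 * H)
        (by nlinarith)).const_mul C
    refine .of_eLpNorm_le hm
      (by simpa using ENNReal.tendsto_ofReal (Real.continuous_sqrt.tendsto 0 |>.comp hdecay)) ?_
    filter_upwards [eventually_gt_atTop 0] with n hn
    obtain ⟨hint, hle⟩ := hC (fun k => ((k : ℝ) / n) ^ (2 * H)) (fun j => B (j / n)) ⌊n * t⌋₊
      (isConcaveVariogram_div_rpow (by linarith) hH2 n) (by positivity)
      ((Real.rpow_le_rpow (by positivity) (mod_cast natCast_div_le_of_le_floor le_rfl)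
        (by linarith)).trans ht) (hB.isGaussianWithVariogram_grid n)
    refine (eLpNorm_one_le_ofReal_sqrt (hm n) hint).trans (ENNReal.ofReal_le_ofReal
      (Real.sqrt_le_sqrt ?_))
    simpa only [Nat.cast_one, one_div] using hle
  · obtain ⟨C, hC⟩ := exists_abs_midpointSum_le hf.growth (ε := 1 / (8 * V)) (by positivity) p
    exact .of_abs_le hm ((hB.tendstoZeroInL1_sum_weightedIncrement (by linarith) hV ht
      (by nlinarith)).const_mul C) fun n ω => hC _ _

theorem tendstoZeroInL1_simpsonSum_sub (hB : IsFractionalBrownianMotion H B P) (hH : 1 / 10 < H)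
    {g : ℝ → ℝ} (hg : SmoothSubGaussian g) (t : ℝ≥0) :
    TendstoZeroInL1 P fun n ω => simpsonSum g (B · ω) t n - (g (B t ω) - g (B 0 ω)) := by
  set V := (t : ℝ) ^ (2 * H) + 1
  have hV : 1 ≤ V := le_add_of_nonneg_left (by positivity)
  have ht : (t : ℝ) ^ (2 * H) ≤ V := le_add_of_nonneg_right zero_le_one
  have hH0 : 0 < H := by linarith
  have hmB := hB.isGaussianProcess.aemeasurable
  have hmg := hg.growth.measurable
  obtain ⟨C, hC⟩ := exists_abs_simpsonSum_sub_le hg (ε := 1 / (8 * V)) (by positivity)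
  have hodd k (hk : k ∈ ({5, 7, 9} : Finset ℕ)) : Odd k ∧ 5 ≤ k := by
    revert k
    decide
  have hmid : TendstoZeroInL1 P fun n ω => ∑ k ∈ {5, 7, 9}, |simpsonCoeff k| *
      |midpointSum (iteratedDeriv k g) k (fun j => B (j / n) ω) ⌊n * t⌋₊| :=
    .sum fun k hk => (hB.tendstoZeroInL1_midpointSum hH (hg.iteratedDeriv k) (hodd k hk).1
      (hodd k hk).2 t).abs.const_mul _
  have hrem := hB.tendstoZeroInL1_sum_weightedIncrement hH0 hV ht (p := 10)
    (by push_cast; linarith)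
  have hend := hB.tendstoZeroInL1_weightedIncrement_floor hH0 hV ht one_ne_zero
  exact .of_abs_le
    (fun n => (hB.aestronglyMeasurable_simpsonSum hg t n).sub
      (AEMeasurable.aestronglyMeasurable (by fun_prop)))
    (hmid.add ((hrem.add hend).const_mul C)) fun n ω => hC (B · ω) t n

end IsFractionalBrownianMotion

end Convergence

theorem proposition3p1_general {Ω : Type*} [MeasurableSpace Ω] (P : Measure Ω) (H : ℝ)
    (hH : 1 / 10 < H) (B : ℝ≥0 → Ω → ℝ) (hB : IsFractionalBrownianMotion H B P) (g : ℝ → ℝ)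
    (hg : SmoothSubGaussian g) (t : ℝ≥0) :
    TendstoInMeasure P (fun n ω => simpsonSum g (fun s => B s ω) t n) atTop
      (fun ω => g (B t ω) - g 0) := by
  have hmB := hB.isGaussianProcess.aemeasurable
  have hmg := hg.growth.measurable
  have hL1 := (hB.tendstoZeroInL1_simpsonSum_sub hH hg t).tendsto_eLpNorm
  refine (tendstoInMeasure_of_tendsto_eLpNorm one_ne_zero
    (fun n => hB.aestronglyMeasurable_simpsonSum hg t n)
    (AEMeasurable.aestronglyMeasurable (by fun_prop)) hL1).congr_right ?_
  filter_upwards [hB.ae_zero (by linarith)] with ω hω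
  rw [hω]

theorem proposition3p1 {Ω : Type*} [MeasurableSpace Ω] (P : Measure Ω)
    (H : ℝ) (hH₁ : 1 / 10 < H) (hH₂ : H < 1 / 2)
    (B : ℝ≥0 → Ω → ℝ) (hB : IsFractionalBrownianMotion H B P)
    (g : ℝ → ℝ) (hg : ContDiff ℝ (⊤ : ℕ∞) g) (hgrowth : ∀ k : ℕ, ModerateGrowth (iteratedDeriv k g))
    (t : ℝ≥0) :
    TendstoInMeasure P (fun (n : ℕ) (ω : Ω) => simpsonSum g (fun s => B s ω) t n) atTop
      (fun ω => g (B t ω) - g 0) :=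
  proposition3p1_general P H hH₁ B hB g (SmoothSubGaussian.of_moderateGrowth hg hgrowth) t
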